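/- Fix $b,d>0$. For $a>0$ and $z\in[0,1]$ let $$p_a(z)=\frac{1-z^2}{\sqrt{a^2(1-z^2)+b^2z^2}},\qquad q_a(z)=-a^2\,\frac{a^2(1-z^2)+b^2(1+z^2)}{d^2\big(a^2(1-z^2)+b^2z^2\big)^{3/2}},$$ and let $\mathcal L_a(v)=\frac1{p_a}\big(-(p_av')'+q_av\big)$ for smooth $v\colon[0,1)\to\mathbb R$. (The equation $\mathcal L_a(v)=0$ is the Jacobi equation for rotationally symmetric normal variations of the planar minimal $2$-sphere $\{x_4=0\}$ in the ellipsoid $\frac{x_1^2}{a^2}+\frac{x_2^2+x_3^2}{b^2}+\frac{x_4^2}{d^2}=1$, where $z=x_1/a$.) Let $$V_{\rm even}=\{v\in C^\infty([0,1)): v'(0)=0,\ \lim_{z\nearrow1}p_a(z)v'(z)=0\},\qquad V_{\rm odd}=\{v\in C^\infty([0,1)): v(0)=0,\ \lim_{z\nearrow1}p_a(z)v'(z)=0\}.$$ Call $a>0$ an even (respectively odd) degeneracy instant if $\lambda=0$ is an eigenvalue of $\mathcal L_a$ on $V_{\rm even}$ (respectively $V_{\rm odd}$), i.e. if $\mathcal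 L_a(v)=0$ for some $v\not\equiv0$ in that space. Then there is a strictly increasing sequence $(a_m)_{m\ge1}$ such that $(a_{2n})_{n\ge1}$ is the increasing enumeration of all even degeneracy instants and $(a_{2n+1})_{n\ge0}$ is the increasing enumeration of all odd degeneracy instants; and this (unique) sequence satisfies $$\limsup_{m\to\infty}\frac{a_m}{m}\le 2d.$$ -/

import Mathlib

open Filter Topology
open scoped ContDiff

noncomputable section

namespace EllipsoidSpheres

/-- The coefficient `p_a` of the Sturm-Liouville equation, for the ellipsoid with semiaxes
`a, b, b, d` (it does not depend on `d`). -/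
def p (a b z : ℝ) : ℝ :=
  (1 - z ^ 2) / Real.sqrt (a ^ 2 * (1 - z ^ 2) + b ^ 2 * z ^ 2)

/-- The coefficient `q_a` of the Sturm-Liouville equation, for the ellipsoid with semiaxes
`a, b, b, d`. -/
def q (a b d z : ℝ) : ℝ :=
  -a ^ 2 * ((a ^ 2 * (1 - z ^ 2) + b ^ 2 * (1 + z ^ 2)) /
    (d ^ 2 * (a ^ 2 * (1 - z ^ 2) + b ^ 2 * z ^ 2) ^ (3 / 2 : ℝ)))

/-- The interval `[0,1)` on which the functions live. A function on `[0,1)` is represented by a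
function on `ℝ`, of which only the values on `[0,1)` are used. -/
def I : Set ℝ := Set.Ico 0 1

/-- The derivative of a function on `[0,1)` (one-sided at `0`). -/
def D (v : ℝ → ℝ) : ℝ → ℝ := derivWithin v I

/-- The Sturm-Liouville operator `L_a v = (1 / p_a) (-(p_a v')' + q_a v)`. -/
def L (a b d : ℝ) (v : ℝ → ℝ) (z : ℝ) : ℝ :=
  1 / p a b z * (-D (fun t => p a b t * D v t) z + q a b d z * v z)

/-- Smooth functions `v` on `[0,1)` with `v'(0) = 0` and `p_a(z) v'(z) → 0` as `z ↗ 1`. -/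
def VEven (a b : ℝ) : Set (ℝ → ℝ) :=
  {v | ContDiffOn ℝ ∞ v I ∧ D v 0 = 0 ∧ Tendsto (fun z => p a b z * D v z) (𝓝[<] 1) (𝓝 0)}

/-- Smooth functions `v` on `[0,1)` with `v(0) = 0` and `p_a(z) v'(z) → 0` as `z ↗ 1`. -/
def VOdd (a b : ℝ) : Set (ℝ → ℝ) :=
  {v | ContDiffOn ℝ ∞ v I ∧ v 0 = 0 ∧ Tendsto (fun z => p a b z * D v z) (𝓝[<] 1) (𝓝 0)}

/-- `lam` is an eigenvalue of the problem `L_a v = lam v` posed in the class `V`. -/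
def IsEigenvalue (a b d : ℝ) (V : Set (ℝ → ℝ)) (lam : ℝ) : Prop :=
  ∃ v ∈ V, (∃ z ∈ I, v z ≠ 0) ∧ ∀ z ∈ I, L a b d v z = lam * v z

/-- Even degeneracy instants. -/
def evenInstants (b d : ℝ) : Set ℝ := {a | 0 < a ∧ IsEigenvalue a b d (VEven a b) 0}

/-- Odd degeneracy instants. -/
def oddInstants (b d : ℝ) : Set ℝ := {a | 0 < a ∧ IsEigenvalue a b d (VOdd a b) 0}

/-- `(u n)_{n ≥ k}` is the strictly increasing enumeration of the set `S`. -/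
def IsIncreasingEnumeration (k : ℕ) (S : Set ℝ) (u : ℕ → ℝ) : Prop :=
  StrictMonoOn u (Set.Ici k) ∧ u '' Set.Ici k = S

/-- `(a m)_{m ≥ 1}` is the merged sequence of degeneracy instants: it is strictly increasing, with
`a (2n)`, `n ≥ 1`, the increasing enumeration of the even instants, and `a (2n+1)`, `n ≥ 0`, the
increasing enumeration of the odd ones. The value `a 0` is irrelevant. -/
def IsMergedSequence (b d : ℝ) (a : ℕ → ℝ) : Prop :=
  StrictMonoOn a (Set.Ici 1) ∧
  IsIncreasingEnumeration 1 (evenInstants b d) (fun n => a (2 * n)) ∧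
  IsIncreasingEnumeration 0 (oddInstants b d) (fun n => a (2 * n + 1))

end EllipsoidSpheres

end

namespace EllipsoidSpheres

/-! ### Scalar differential equations on `[0,T]` -/

theorem hasDerivWithinAt_Ici_of_Icc {f : ℝ → ℝ} {f' a b t : ℝ} (ht : t ∈ Set.Ico a b)
    (h : HasDerivWithinAt f f' (Set.Icc a b) t) : HasDerivWithinAt f f' (Set.Ici t) t :=
  h.mono_of_mem_nhdsWithin (mem_of_superset (Icc_mem_nhdsGE ht.2) (Set.Icc_subset_Icc_left ht.1))

theorem exists_solution {f : ℝ → ℝ → ℝ} {K M : ℝ} (hK : 0 ≤ K) (hM : 0 ≤ M)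
    (hlip : ∀ t ∈ Set.Icc (0 : ℝ) 1, ∀ x y, |f t x - f t y| ≤ K * |x - y|)
    (hcont : ∀ x, ContinuousOn (fun t => f t x) (Set.Icc 0 1))
    (hbd : ∀ t ∈ Set.Icc (0 : ℝ) 1, ∀ x, |f t x| ≤ M) :
    ∃ θ : ℝ → ℝ, θ 0 = 0 ∧
      ∀ t ∈ Set.Icc (0 : ℝ) 1, HasDerivWithinAt θ (f t (θ t)) (Set.Icc 0 1) t := by
  lift K to NNReal using hK
  lift M to NNReal using hM
  have hPL : IsPicardLindelof f (tmin := 0) (tmax := 1) ⟨0, by simp⟩ (0 : ℝ)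
      M 0 M K :=
    { lipschitzOnWith := fun t ht => LipschitzOnWith.of_dist_le_mul fun x _ y _ => by
        simpa [Real.dist_eq] using hlip t ht x y
      continuousOn := fun x _ => hcont x
      norm_le := fun t ht x _ => by simpa using hbd t ht x
      mul_max_le := by simp }
  obtain ⟨θ, h0, h⟩ := hPL.exists_eq_forall_mem_Icc_hasDerivWithinAt₀
  exact ⟨θ, h0, h⟩

theorem le_of_subsolution_of_supersolution {f : ℝ → ℝ → ℝ} {K T : ℝ} {θ₁ θ₂ θ₁' θ₂' : ℝ → ℝ}
    (hlip : ∀ t ∈ Set.Icc (0 : ℝ) T, ∀ x y, |f t x - f t y| ≤ K * |x - y|)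
    (h₁ : ∀ t ∈ Set.Icc (0 : ℝ) T, HasDerivWithinAt θ₁ (θ₁' t) (Set.Icc 0 T) t)
    (h₂ : ∀ t ∈ Set.Icc (0 : ℝ) T, HasDerivWithinAt θ₂ (θ₂' t) (Set.Icc 0 T) t)
    (hsub : ∀ t ∈ Set.Icc (0 : ℝ) T, θ₁' t ≤ f t (θ₁ t))
    (hsup : ∀ t ∈ Set.Icc (0 : ℝ) T, f t (θ₂ t) ≤ θ₂' t)
    (h0 : θ₁ 0 ≤ θ₂ 0) : ∀ t ∈ Set.Icc (0 : ℝ) T, θ₁ t ≤ θ₂ t := by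
  have key : ∀ ε > 0, ∀ t ∈ Set.Icc (0 : ℝ) T, θ₁ t ≤ θ₂ t + ε * Real.exp ((K + 1) * t) := by
    intro ε hε
    have hE : ∀ t : ℝ, HasDerivAt (fun t => ε * Real.exp ((K + 1) * t))
        (ε * (Real.exp ((K + 1) * t) * (K + 1))) t := fun t => by
      simpa using (((hasDerivAt_id t).const_mul (K + 1)).exp.const_mul ε)
    refine image_le_of_deriv_right_lt_deriv_boundary' (f' := θ₁')
      (B' := fun t => θ₂' t + ε * (Real.exp ((K + 1) * t) * (K + 1)))
      (fun t ht => (h₁ t ht).continuousWithinAt)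
      (fun t ht => hasDerivWithinAt_Ici_of_Icc ht (h₁ t ⟨ht.1, ht.2.le⟩)) ?_
      (fun t ht => ((h₂ t ht).add (hE t).hasDerivWithinAt).continuousWithinAt)
      (fun t ht => hasDerivWithinAt_Ici_of_Icc ht
        ((h₂ t ⟨ht.1, ht.2.le⟩).add (hE t).hasDerivWithinAt)) ?_
    · simp only [mul_zero, Real.exp_zero]
      linarith
    · intro t ht heq
      have ht' : t ∈ Set.Icc (0 : ℝ) T := ⟨ht.1, ht.2.le⟩
      have hpos : 0 < ε * Real.exp ((K + 1) * t) := by positivity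
      have h := hlip t ht' (θ₁ t) (θ₂ t)
      rw [heq, add_sub_cancel_left, abs_of_pos hpos, ← heq] at h
      have h3 := (abs_le.1 h).2
      have := hsub t ht'
      have := hsup t ht'
      nlinarith
  intro t ht
  refine le_of_forall_pos_le_add fun ε hε => ?_
  have := key (ε / Real.exp ((K + 1) * t)) (by positivity) t ht
  rwa [div_mul_cancel₀ _ (Real.exp_pos _).ne'] at this

theorem lt_of_le_of_deriv_lt {θ₁ θ₂ : ℝ → ℝ} {a b : ℝ}
    (hle : ∀ t ∈ Set.Icc (0 : ℝ) 1, θ₁ t ≤ θ₂ t)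
    (h₁ : HasDerivWithinAt θ₁ a (Set.Icc 0 1) 1)
    (h₂ : HasDerivWithinAt θ₂ b (Set.Icc 0 1) 1)
    (hab : θ₁ 1 = θ₂ 1 → a < b) : θ₁ 1 < θ₂ 1 := by
  refine lt_of_le_of_ne (hle 1 (by simp)) fun heq => ?_
  have hd := h₂.sub h₁
  rw [hasDerivWithinAt_iff_tendsto_slope] at hd
  have hne : (𝓝[Set.Icc (0 : ℝ) 1 \ {1}] 1).NeBot := by
    have : Set.Icc (0 : ℝ) 1 \ {1} = Set.Ico 0 1 := by simp
    rw [this]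
    exact (nhdsWithin_Ico_eq_nhdsLT (zero_lt_one' ℝ)).symm ▸ inferInstance
  have : b - a ≤ 0 := le_of_tendsto hd <| by
    filter_upwards [self_mem_nhdsWithin] with t ht
    have h1 : t < 1 := lt_of_le_of_ne ht.1.2 ht.2
    have h2 := hle t ht.1
    rw [slope_def_field]
    refine div_nonpos_of_nonneg_of_nonpos ?_ (by linarith)
    simp only [Pi.sub_apply]
    linarith
  linarith [hab heq]

theorem abs_sub_le_gronwallBound {f g : ℝ → ℝ → ℝ} {K ε : ℝ} {θ₁ θ₂ : ℝ → ℝ} (hK : 0 ≤ K)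
    (hlip : ∀ t ∈ Set.Icc (0 : ℝ) 1, ∀ x y, |f t x - f t y| ≤ K * |x - y|)
    (h₁ : ∀ t ∈ Set.Icc (0 : ℝ) 1, HasDerivWithinAt θ₁ (f t (θ₁ t)) (Set.Icc 0 1) t)
    (h₂ : ∀ t ∈ Set.Icc (0 : ℝ) 1, HasDerivWithinAt θ₂ (g t (θ₂ t)) (Set.Icc 0 1) t)
    (hfg : ∀ t ∈ Set.Icc (0 : ℝ) 1, ∀ x, |g t x - f t x| ≤ ε)
    (h0 : θ₁ 0 = θ₂ 0) : |θ₁ 1 - θ₂ 1| ≤ gronwallBound 0 K ε 1 := by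
  lift K to NNReal using hK
  have := dist_le_of_approx_trajectories_ODE_of_mem (v := f) (s := fun _ => Set.univ)
    (K := K) (f := θ₁) (g := θ₂) (a := 0) (b := 1) (εf := 0) (εg := ε) (δ := 0)
    (fun t ht => LipschitzOnWith.of_dist_le_mul fun x _ y _ => by
        simpa [Real.dist_eq] using hlip t ⟨ht.1, ht.2.le⟩ x y)
    (fun t ht => (h₁ t ht).continuousWithinAt)
    (fun t ht => hasDerivWithinAt_Ici_of_Icc ht (h₁ t ⟨ht.1, ht.2.le⟩))
    (fun t _ => by simp) (fun _ _ => trivial)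
    (fun t ht => (h₂ t ht).continuousWithinAt)
    (fun t ht => hasDerivWithinAt_Ici_of_Icc ht (h₂ t ⟨ht.1, ht.2.le⟩))
    (fun t ht => by simpa [Real.dist_eq] using hfg t ⟨ht.1, ht.2.le⟩ _) (fun _ _ => trivial)
    (by simp [h0]) 1 (by simp)
  simpa [Real.dist_eq] using this

end EllipsoidSpheres

namespace EllipsoidSpheres

/-! ### The coefficients in the Gauss map coordinate -/

/-- The coefficient `(a²(1-z²)+b²z²)/b²` in terms of `α = a²/b²` and `τ = 1 - y`, where
`y` is the axial component of the unit normal. -/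
noncomputable def G (α τ : ℝ) : ℝ := α / (τ * (2 - τ) + α * (1 - τ) ^ 2)

variable {α α' τ k C : ℝ}

theorem min_le_G_denom (hτ : τ ∈ Set.Icc (0 : ℝ) 1) :
    min 1 α ≤ τ * (2 - τ) + α * (1 - τ) ^ 2 := by
  obtain ⟨h0, h1⟩ := hτ
  have hy : (1 - τ) ^ 2 ≤ 1 := by nlinarith
  have hs : (0 : ℝ) ≤ τ * (2 - τ) := mul_nonneg h0 (by linarith)
  nlinarith [min_le_left 1 α, min_le_right 1 α, sq_nonneg (1 - τ)]

theorem G_denom_pos (hα : 0 < α) (hτ : τ ∈ Set.Icc (0 : ℝ) 1) :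
    0 < τ * (2 - τ) + α * (1 - τ) ^ 2 :=
  (lt_min one_pos hα).trans_le (min_le_G_denom hτ)

theorem G_pos (hα : 0 < α) (hτ : τ ∈ Set.Icc (0 : ℝ) 1) : 0 < G α τ :=
  div_pos hα (G_denom_pos hα hτ)

theorem G_le (hα : 0 < α) (hτ : τ ∈ Set.Icc (0 : ℝ) 1) : G α τ ≤ 1 + α := by
  rw [G, div_le_iff₀ (G_denom_pos hα hτ)]
  obtain ⟨h0, h1⟩ := hτ
  have hs : (0 : ℝ) ≤ τ * (2 - τ) := mul_nonneg h0 (by linarith)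
  nlinarith [mul_nonneg hα.le hs, mul_nonneg (mul_nonneg hα.le hα.le) (sq_nonneg (1 - τ))]

theorem G_le_one (hα : 0 < α) (hα1 : α ≤ 1) (hτ : τ ∈ Set.Icc (0 : ℝ) 1) : G α τ ≤ 1 := by
  rw [G, div_le_one (G_denom_pos hα hτ)]
  simpa [hα1] using min_le_G_denom (α := α) hτ

theorem G_mul_le (hα : 0 < α) (hτ : τ ∈ Set.Icc (0 : ℝ) 1) : G α τ * τ ≤ α := by
  rw [G, div_mul_eq_mul_div, div_le_iff₀ (G_denom_pos hα hτ)]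
  obtain ⟨h0, h1⟩ := hτ
  refine mul_le_mul_of_nonneg_left ?_ hα.le
  nlinarith [mul_nonneg hα.le (sq_nonneg (1 - τ))]

theorem G_sub_G (hα : 0 < α) (hα' : 0 < α') (hτ : τ ∈ Set.Icc (0 : ℝ) 1) :
    G α' τ - G α τ = τ * (2 - τ) * (α' - α) /
      ((τ * (2 - τ) + α * (1 - τ) ^ 2) * (τ * (2 - τ) + α' * (1 - τ) ^ 2)) := by
  have h1 := (G_denom_pos hα hτ).ne'
  have h2 := (G_denom_pos hα' hτ).ne'
  rw [G, G, div_sub_div _ _ h2 h1, mul_comm (τ * (2 - τ) + α' * (1 - τ) ^ 2)]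
  congr 1 <;> ring

theorem G_mono (hα : 0 < α) (h : α ≤ α') (hτ : τ ∈ Set.Icc (0 : ℝ) 1) : G α τ ≤ G α' τ := by
  have h1 := G_denom_pos hα hτ
  have h2 := G_denom_pos (hα.trans_le h) hτ
  rw [← sub_nonneg, G_sub_G hα (hα.trans_le h) hτ]
  exact div_nonneg (mul_nonneg (mul_nonneg hτ.1 (by linarith [hτ.2])) (by linarith))
    (mul_pos h1 h2).le

theorem G_strictMono_of_pos (hα : 0 < α) (h : α < α') (hτ : τ ∈ Set.Ioc (0 : ℝ) 1) :
    G α τ < G α' τ := by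
  have hτ' : τ ∈ Set.Icc (0 : ℝ) 1 := ⟨hτ.1.le, hτ.2⟩
  have h1 := G_denom_pos hα hτ'
  have h2 := G_denom_pos (hα.trans h) hτ'
  rw [← sub_pos, G_sub_G hα (hα.trans h) hτ']
  exact div_pos (mul_pos (mul_pos hτ.1 (by linarith [hτ.2])) (by linarith)) (mul_pos h1 h2)

theorem abs_G_sub_le {μ : ℝ} (hμ : 0 < μ) (hμ1 : μ ≤ 1) (hα : μ ≤ α) (hα' : μ ≤ α')
    (hτ : τ ∈ Set.Icc (0 : ℝ) 1) : |G α' τ - G α τ| ≤ |α' - α| / μ ^ 2 := by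
  have h1 : μ ≤ _ := (le_min hμ1 hα).trans (min_le_G_denom hτ)
  have h2 : μ ≤ _ := (le_min hμ1 hα').trans (min_le_G_denom hτ)
  have hs : (0 : ℝ) ≤ τ * (2 - τ) := mul_nonneg hτ.1 (by linarith [hτ.2])
  have hs1 : τ * (2 - τ) ≤ 1 := by nlinarith [sq_nonneg (1 - τ)]
  rw [G_sub_G (hμ.trans_le hα) (hμ.trans_le hα') hτ, abs_div, abs_mul, abs_of_nonneg hs,
    abs_of_pos (mul_pos (hμ.trans_le h1) (hμ.trans_le h2))]
  have h3 : τ * (2 - τ) * |α' - α| ≤ |α' - α| := mul_le_of_le_one_left (abs_nonneg _) hs1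
  have h4 : μ ^ 2 ≤ (τ * (2 - τ) + α * (1 - τ) ^ 2) * (τ * (2 - τ) + α' * (1 - τ) ^ 2) := by
    rw [sq]
    exact mul_le_mul h1 h2 hμ.le (hμ.le.trans h1)
  exact div_le_div₀ (abs_nonneg _) h3 (by positivity) h4

theorem continuousOn_G (hα : 0 < α) : ContinuousOn (G α) (Set.Icc 0 1) := by
  unfold G
  exact continuousOn_const.div (by fun_prop) fun τ hτ => (G_denom_pos hα hτ).ne'

/-! ### The angular velocity and its truncation -/

/-- The angular velocity of the phase of the Sturm-Liouville equation. -/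
noncomputable def rate (k α τ θ : ℝ) : ℝ :=
  k * ((1 + G α τ) * Real.cos θ ^ 2 + G α τ * (Real.sin θ ^ 2 / τ / (2 - τ)))

/-- A truncation of the singular factor `sin² θ / (τ (2 - τ))`. -/
noncomputable def truncatedSinSq (C τ θ : ℝ) : ℝ := min |Real.sin θ| (C * τ) ^ 2 / τ / (2 - τ)

/-- The angular velocity with truncated singular factor. -/
noncomputable def truncatedRate (k α C τ θ : ℝ) : ℝ :=
  k * ((1 + G α τ) * Real.cos θ ^ 2 + G α τ * truncatedSinSq C τ θ)

theorem truncatedSinSq_nonneg (hτ : τ ∈ Set.Icc (0 : ℝ) 1) (θ : ℝ) :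
    0 ≤ truncatedSinSq C τ θ :=
  div_nonneg (div_nonneg (sq_nonneg _) hτ.1) (by linarith [hτ.2])

theorem truncatedSinSq_le_of_abs_min_le {c : ℝ} (hC : 0 ≤ C) (hτ : τ ∈ Set.Icc (0 : ℝ) 1) {θ : ℝ}
    (h : min |Real.sin θ| (C * τ) ≤ c * τ) : truncatedSinSq C τ θ ≤ c ^ 2 * τ := by
  obtain ⟨h0, h1⟩ := hτ
  rcases h0.eq_or_lt with rfl | h0
  · simp [truncatedSinSq]
  have hm : 0 ≤ min |Real.sin θ| (C * τ) := le_min (abs_nonneg _) (by positivity)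
  have h2 : min |Real.sin θ| (C * τ) ^ 2 ≤ (c * τ) ^ 2 := pow_le_pow_left₀ hm h 2
  rw [truncatedSinSq, div_div, div_le_iff₀ (by nlinarith)]
  have : 0 ≤ c ^ 2 * τ ^ 2 * (1 - τ) := by
    have : 0 ≤ 1 - τ := by linarith
    positivity
  nlinarith

theorem truncatedSinSq_le (hC : 0 ≤ C) (hτ : τ ∈ Set.Icc (0 : ℝ) 1) (θ : ℝ) :
    truncatedSinSq C τ θ ≤ C ^ 2 * τ :=
  truncatedSinSq_le_of_abs_min_le hC hτ (min_le_right _ _)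

theorem truncatedSinSq_eq {θ : ℝ} (h : |Real.sin θ| ≤ C * τ) :
    truncatedSinSq C τ θ = Real.sin θ ^ 2 / τ / (2 - τ) := by
  rw [truncatedSinSq, min_eq_left h, sq_abs]

theorem truncatedRate_eq {θ : ℝ} (h : |Real.sin θ| ≤ C * τ) :
    truncatedRate k α C τ θ = rate k α τ θ := by
  rw [truncatedRate, truncatedSinSq_eq h, rate]

theorem abs_truncatedSinSq_sub_le (hC : 0 ≤ C) (hτ : τ ∈ Set.Icc (0 : ℝ) 1) (x y : ℝ) :
    |truncatedSinSq C τ x - truncatedSinSq C τ y| ≤ 2 * C * |x - y| := by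
  obtain ⟨h0, h1⟩ := hτ
  rcases h0.eq_or_lt with rfl | h0
  · simp only [truncatedSinSq, div_zero, zero_div, sub_self, abs_zero]
    positivity
  have hCτ : 0 ≤ C * τ := by positivity
  have hd : |min |Real.sin x| (C * τ) - min |Real.sin y| (C * τ)| ≤ |x - y| :=
    (abs_min_sub_min_le_max _ _ _ _).trans (by
      rw [sub_self, abs_zero, max_eq_left (abs_nonneg _)]
      refine (abs_abs_sub_abs_le_abs_sub _ _).trans ?_
      simpa [Real.dist_eq] using Real.lipschitzWith_sin.dist_le_mul x y)
  have hs : |min |Real.sin x| (C * τ) + min |Real.sin y| (C * τ)| ≤ 2 * C * τ := by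
    rw [abs_of_nonneg (add_nonneg (le_min (abs_nonneg _) hCτ) (le_min (abs_nonneg _) hCτ))]
    linarith [min_le_right |Real.sin x| (C * τ), min_le_right |Real.sin y| (C * τ)]
  have hpos : 0 < τ * (2 - τ) := by nlinarith
  rw [truncatedSinSq, truncatedSinSq, div_div, div_div, ← sub_div, sq_sub_sq, abs_div, abs_mul,
    abs_of_pos hpos, div_le_iff₀ hpos]
  calc _ ≤ 2 * C * τ * |x - y| := mul_le_mul hs hd (abs_nonneg _) (by positivity)
    _ ≤ 2 * C * |x - y| * (τ * (2 - τ)) := by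
      have : 0 ≤ C * |x - y| * τ * (1 - τ) := by
        have : 0 ≤ 1 - τ := by linarith
        positivity
      nlinarith

theorem continuousOn_truncatedSinSq (hC : 0 ≤ C) (θ : ℝ) :
    ContinuousOn (fun τ => truncatedSinSq C τ θ) (Set.Icc 0 1) := by
  intro τ hτ
  rcases hτ.1.eq_or_lt with rfl | h0
  · have h1 : Tendsto (fun τ : ℝ => C ^ 2 * τ) (𝓝[Set.Icc 0 1] 0) (𝓝 0) := by
      have : Tendsto (fun τ : ℝ => C ^ 2 * τ) (𝓝 0) (𝓝 (C ^ 2 * 0)) :=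
        (continuous_const.mul continuous_id).tendsto _
      rw [mul_zero] at this
      exact this.mono_left nhdsWithin_le_nhds
    have h2 : truncatedSinSq C 0 θ = 0 := by simp [truncatedSinSq]
    rw [ContinuousWithinAt, h2]
    refine tendsto_of_tendsto_of_tendsto_of_le_of_le' tendsto_const_nhds h1 ?_ ?_
    · filter_upwards [self_mem_nhdsWithin] with t ht using truncatedSinSq_nonneg ht θ
    · filter_upwards [self_mem_nhdsWithin] with t ht using truncatedSinSq_le hC ht θ
  · have h2 : (2 : ℝ) - τ ≠ 0 := by linarith [hτ.2]
    refine ContinuousAt.continuousWithinAt ?_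
    unfold truncatedSinSq
    refine ContinuousAt.div (ContinuousAt.div ?_ continuousAt_id h0.ne') (by fun_prop) h2
    have hc : Continuous fun τ : ℝ => min |Real.sin θ| (C * τ) := by fun_prop
    exact hc.continuousAt.pow 2

theorem abs_cos_sq_sub_le (x y : ℝ) : |Real.cos x ^ 2 - Real.cos y ^ 2| ≤ 2 * |x - y| := by
  have hd : |Real.cos x - Real.cos y| ≤ |x - y| := by
    simpa [Real.dist_eq] using Real.lipschitzWith_cos.dist_le_mul x y
  have hs : |Real.cos x + Real.cos y| ≤ 2 :=
    (abs_add_le _ _).trans (by linarith [Real.abs_cos_le_one x, Real.abs_cos_le_one y])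
  rw [sq_sub_sq, abs_mul]
  exact mul_le_mul hs hd (abs_nonneg _) two_pos.le

theorem truncatedRate_nonneg (hk : 0 ≤ k) (hα : 0 < α) (hτ : τ ∈ Set.Icc (0 : ℝ) 1) (θ : ℝ) :
    0 ≤ truncatedRate k α C τ θ := by
  have := G_pos hα hτ
  have := truncatedSinSq_nonneg (C := C) hτ θ
  unfold truncatedRate
  positivity

theorem truncatedRate_le_of_abs_min_le {c θ : ℝ} (hk : 0 ≤ k) (hα : 0 < α) (hC : 0 ≤ C)
    (hτ : τ ∈ Set.Icc (0 : ℝ) 1) (h : min |Real.sin θ| (C * τ) ≤ c * τ) :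
    truncatedRate k α C τ θ ≤ k * ((2 + α) + (1 + α) * (c ^ 2 * τ)) := by
  have h1 := G_pos hα hτ
  have h2 := G_le hα hτ
  refine mul_le_mul_of_nonneg_left (add_le_add ?_ ?_) hk
  · exact (mul_le_of_le_one_right (by positivity) (Real.cos_sq_le_one θ)).trans (by linarith)
  · exact mul_le_mul h2 (truncatedSinSq_le_of_abs_min_le hC hτ h) (truncatedSinSq_nonneg hτ θ)
      (by positivity)

theorem abs_truncatedRate_sub_le (hk : 0 ≤ k) (hα : 0 < α) (hC : 0 ≤ C)
    (hτ : τ ∈ Set.Icc (0 : ℝ) 1) (x y : ℝ) :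
    |truncatedRate k α C τ x - truncatedRate k α C τ y| ≤
      k * ((2 + α) * 2 + (1 + α) * (2 * C)) * |x - y| := by
  have h1 := G_pos hα hτ
  have h2 := G_le hα hτ
  have h3 := abs_cos_sq_sub_le x y
  have h4 := abs_truncatedSinSq_sub_le hC hτ x y
  have : truncatedRate k α C τ x - truncatedRate k α C τ y =
      k * ((1 + G α τ) * (Real.cos x ^ 2 - Real.cos y ^ 2) +
        G α τ * (truncatedSinSq C τ x - truncatedSinSq C τ y)) := by
    unfold truncatedRate; ring
  rw [this, abs_mul, abs_of_nonneg hk, mul_assoc]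
  refine mul_le_mul_of_nonneg_left ((abs_add_le _ _).trans ?_) hk
  rw [abs_mul, abs_mul, abs_of_pos h1, abs_of_pos (by linarith : 0 < 1 + G α τ)]
  have h5 := mul_le_mul (by linarith : 1 + G α τ ≤ 2 + α) h3 (abs_nonneg _) (by positivity)
  have h6 := mul_le_mul h2 h4 (abs_nonneg _) (by positivity)
  linarith

theorem abs_truncatedRate_sub_param_le {μ : ℝ} (hk : 0 ≤ k) (hC : 0 ≤ C) (hμ : 0 < μ)
    (hμ1 : μ ≤ 1) (hα : μ ≤ α) (hα' : μ ≤ α') (hτ : τ ∈ Set.Icc (0 : ℝ) 1) (θ : ℝ) :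
    |truncatedRate k α' C τ θ - truncatedRate k α C τ θ| ≤
      k * (1 + C ^ 2) * (|α' - α| / μ ^ 2) := by
  have h1 := truncatedSinSq_nonneg (C := C) hτ θ
  have h2 : truncatedSinSq C τ θ ≤ C ^ 2 :=
    (truncatedSinSq_le hC hτ θ).trans (mul_le_of_le_one_right (sq_nonneg _) hτ.2)
  have : truncatedRate k α' C τ θ - truncatedRate k α C τ θ =
      k * (Real.cos θ ^ 2 + truncatedSinSq C τ θ) * (G α' τ - G α τ) := by
    unfold truncatedRate; ring
  have h3 : 0 ≤ Real.cos θ ^ 2 + truncatedSinSq C τ θ := by positivity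
  rw [this, abs_mul, abs_of_nonneg (mul_nonneg hk h3)]
  exact mul_le_mul (mul_le_mul_of_nonneg_left (add_le_add (Real.cos_sq_le_one θ) h2) hk)
    (abs_G_sub_le hμ hμ1 hα hα' hτ) (abs_nonneg _) (by positivity)

theorem continuousOn_truncatedRate (hα : 0 < α) (hC : 0 ≤ C) (θ : ℝ) :
    ContinuousOn (fun τ => truncatedRate k α C τ θ) (Set.Icc 0 1) := by
  unfold truncatedRate
  have := continuousOn_G hα
  have := continuousOn_truncatedSinSq hC θ
  fun_prop

theorem truncatedRate_mono (hk : 0 ≤ k) (hα : 0 < α) (h : α ≤ α') (hτ : τ ∈ Set.Icc (0 : ℝ) 1)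
    (θ : ℝ) : truncatedRate k α C τ θ ≤ truncatedRate k α' C τ θ := by
  have := G_mono hα h hτ
  have := truncatedSinSq_nonneg (C := C) hτ θ
  unfold truncatedRate
  gcongr

theorem rate_strictMono (hk : 0 < k) (hα : 0 < α) (h : α < α') (hτ : τ ∈ Set.Ioc (0 : ℝ) 1)
    (θ : ℝ) : rate k α τ θ < rate k α' τ θ := by
  have hG := G_strictMono_of_pos hα h hτ
  have h2 : 0 < 2 - τ := by linarith [hτ.2]
  have hpos : 0 < Real.cos θ ^ 2 + Real.sin θ ^ 2 / τ / (2 - τ) := by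
    rcases eq_or_ne (Real.sin θ) 0 with h0 | h0
    · have := Real.sin_sq_add_cos_sq θ
      rw [h0] at this ⊢
      norm_num at this ⊢
      rw [sq_pos_iff]; rintro h; simp [h] at this
    · have := hτ.1
      positivity
  have : rate k α' τ θ - rate k α τ θ =
      k * (Real.cos θ ^ 2 + Real.sin θ ^ 2 / τ / (2 - τ)) * (G α' τ - G α τ) := by
    unfold rate; ring
  have := mul_pos (mul_pos hk hpos) (sub_pos.2 hG)
  linarith

end EllipsoidSpheres

namespace EllipsoidSpheres

/-! ### The phase -/

/-- A truncation level above which the truncation does not affect the phase. -/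
noncomputable def truncationLevel (k α : ℝ) : ℝ :=
  2 * k * (2 + α) * (1 + 2 * k * (1 + α))

/-- The phase function of the solution that is regular at the endpoint `τ = 0`. -/
structure IsPhase (k α : ℝ) (θ : ℝ → ℝ) : Prop where
  map_zero : θ 0 = 0
  hasDeriv : ∀ t ∈ Set.Icc (0 : ℝ) 1, HasDerivWithinAt θ (rate k α t (θ t)) (Set.Icc 0 1) t
  abs_sin_le : ∀ t ∈ Set.Icc (0 : ℝ) 1, |Real.sin (θ t)| ≤ truncationLevel k α * t

variable {α α' τ k C : ℝ} {θ θ' : ℝ → ℝ}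

theorem truncationLevel_pos (hk : 0 < k) (hα : 0 < α) : 0 < truncationLevel k α := by
  unfold truncationLevel
  positivity

theorem truncationLevel_mono (hk : 0 < k) (hα : 0 < α) (h : α ≤ α') :
    truncationLevel k α ≤ truncationLevel k α' := by
  have : 0 < α' := hα.trans_le h
  unfold truncationLevel
  gcongr

theorem exists_isPhase (hk : 0 < k) (hα : 0 < α) : ∃ θ, IsPhase k α θ := by
  set C := truncationLevel k α with hC
  have hCpos : 0 < C := truncationLevel_pos hk hα
  obtain ⟨θ, h0, hθ⟩ := exists_solution (f := truncatedRate k α C)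
    (K := k * ((2 + α) * 2 + (1 + α) * (2 * C))) (M := k * ((2 + α) + (1 + α) * C ^ 2))
    (by positivity) (by positivity) (fun t ht => abs_truncatedRate_sub_le hk.le hα hCpos.le ht)
    (continuousOn_truncatedRate hα hCpos.le) fun t ht x => by
      rw [abs_of_nonneg (truncatedRate_nonneg hk.le hα ht x)]
      refine (truncatedRate_le_of_abs_min_le hk.le hα hCpos.le ht (min_le_right _ _)).trans ?_
      gcongr
      exact mul_le_of_le_one_right (sq_nonneg _) ht.2
  set K := 2 * k * (2 + α) with hK
  have hKpos : 0 < K := by positivity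
  have hCK : C = K * (1 + 2 * k * (1 + α)) := rfl
  set T := min 1 (1 / C) with hT
  have hT1 : T ≤ 1 := min_le_left _ _
  have hsub : Set.Icc 0 T ⊆ Set.Icc 0 1 := Set.Icc_subset_Icc_right hT1
  have hlip : ∀ t ∈ Set.Icc (0 : ℝ) T, ∀ x y,
      |truncatedRate k α C t x - truncatedRate k α C t y| ≤
        k * ((2 + α) * 2 + (1 + α) * (2 * C)) * |x - y| :=
    fun t ht => abs_truncatedRate_sub_le hk.le hα hCpos.le (hsub ht)
  have hθT : ∀ t ∈ Set.Icc 0 T, HasDerivWithinAt θ (truncatedRate k α C t (θ t)) (Set.Icc 0 T) t :=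
    fun t ht => (hθ t (hsub ht)).mono hsub
  have hup : ∀ t ∈ Set.Icc 0 T, θ t ≤ K * t := by
    refine le_of_subsolution_of_supersolution hlip hθT
      (fun t _ => ((hasDerivAt_id t).const_mul K).hasDerivWithinAt) (fun t _ => le_rfl) ?_
      (by simp [h0])
    intro t ht
    have hKt : 0 ≤ K * t := mul_nonneg hKpos.le ht.1
    have hmin : min |Real.sin (K * t)| (C * t) ≤ K * t :=
      (min_le_left _ _).trans ((Real.abs_sin_le_abs).trans (abs_of_nonneg hKt).le)
    refine (truncatedRate_le_of_abs_min_le hk.le hα hCpos.le (hsub ht) hmin).trans ?_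
    have htC : C * t ≤ 1 := by
      have : t ≤ 1 / C := ht.2.trans (min_le_right _ _)
      rwa [le_div_iff₀ hCpos, mul_comm] at this
    rw [hCK] at htC
    have h1 : 0 ≤ K * t := by have := ht.1; positivity
    have h2 : 2 * k * (1 + α) * (K * t) ≤ 1 := by nlinarith
    have h3 : 2 * k * (1 + α) * (K * t) * K ≤ 1 * K := mul_le_mul_of_nonneg_right h2 hKpos.le
    have h4 : k * (2 + α) = K / 2 := by rw [hK]; ring
    rw [mul_add, h4]
    linarith
  have hlow : ∀ t ∈ Set.Icc 0 T, 0 ≤ θ t := by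
    refine le_of_subsolution_of_supersolution (θ₁ := fun _ => 0) hlip
      (fun t _ => hasDerivWithinAt_const _ _ _) hθT
      (fun t ht => truncatedRate_nonneg hk.le hα (hsub ht) _) (fun t _ => le_rfl) (by simp [h0])
  have hsin : ∀ t ∈ Set.Icc (0 : ℝ) 1, |Real.sin (θ t)| ≤ C * t := by
    intro t ht
    rcases le_total t (1 / C) with h | h
    · have hm : t ∈ Set.Icc 0 T := ⟨ht.1, le_min ht.2 h⟩
      refine (Real.abs_sin_le_abs).trans ?_
      rw [abs_of_nonneg (hlow t hm)]
      refine (hup t hm).trans (mul_le_mul_of_nonneg_right ?_ ht.1)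
      rw [hCK]
      exact le_mul_of_one_le_right hKpos.le (by linarith [show 0 < 2 * k * (1 + α) by positivity])
    · refine (Real.abs_sin_le_one _).trans ?_
      rwa [div_le_iff₀ hCpos, mul_comm] at h
  exact ⟨θ, h0, fun t ht => truncatedRate_eq (hsin t ht) ▸ hθ t ht, hsin⟩

theorem IsPhase.hasDeriv_truncated (h : IsPhase k α θ) (hC : truncationLevel k α ≤ C) {t : ℝ}
    (ht : t ∈ Set.Icc (0 : ℝ) 1) :
    HasDerivWithinAt θ (truncatedRate k α C t (θ t)) (Set.Icc 0 1) t := by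
  rw [truncatedRate_eq ((h.abs_sin_le t ht).trans (mul_le_mul_of_nonneg_right hC ht.1))]
  exact h.hasDeriv t ht

theorem IsPhase.le_of_le (hk : 0 < k) (hα : 0 < α) (hαα' : α ≤ α') (h : IsPhase k α θ)
    (h' : IsPhase k α' θ') : ∀ t ∈ Set.Icc (0 : ℝ) 1, θ t ≤ θ' t := by
  have hC := truncationLevel_mono hk hα hαα'
  refine le_of_subsolution_of_supersolution
    (fun t ht => abs_truncatedRate_sub_le hk.le hα
      (truncationLevel_pos hk (hα.trans_le hαα')).le ht)
    (fun t ht => h.hasDeriv_truncated hC ht) (fun t ht => h'.hasDeriv_truncated le_rfl ht)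
    (fun t _ => le_rfl) (fun t ht => truncatedRate_mono hk.le hα hαα' ht _) ?_
  rw [h.map_zero, h'.map_zero]

theorem IsPhase.lt_of_lt (hk : 0 < k) (hα : 0 < α) (hαα' : α < α') (h : IsPhase k α θ)
    (h' : IsPhase k α' θ') : θ 1 < θ' 1 := by
  refine lt_of_le_of_deriv_lt (h.le_of_le hk hα hαα'.le h') (h.hasDeriv 1 (by simp))
    (h'.hasDeriv 1 (by simp)) fun heq => ?_
  rw [heq]
  exact rate_strictMono hk hα hαα' (by simp) _

theorem IsPhase.abs_sub_le {μ : ℝ} (hk : 0 < k) (hμ : 0 < μ)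
    (hμ1 : μ ≤ 1) (hα : μ ≤ α) (hα' : μ ≤ α') (hC : truncationLevel k α ≤ C)
    (hC' : truncationLevel k α' ≤ C) (h : IsPhase k α θ) (h' : IsPhase k α' θ') :
    |θ 1 - θ' 1| ≤ gronwallBound 0 (k * ((2 + α) * 2 + (1 + α) * (2 * C)))
      (k * (1 + C ^ 2) * (|α' - α| / μ ^ 2)) 1 := by
  have hα0 : 0 < α := hμ.trans_le hα
  have hC0 : 0 ≤ C := (truncationLevel_pos hk hα0).le.trans hC
  refine abs_sub_le_gronwallBound (by positivity)
    (fun t ht => abs_truncatedRate_sub_le hk.le hα0 hC0 ht)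
    (fun t ht => h.hasDeriv_truncated hC ht) (fun t ht => h'.hasDeriv_truncated hC' ht)
    (fun t ht => abs_truncatedRate_sub_param_le hk.le hC0 hμ hμ1 hα hα' ht) ?_
  rw [h.map_zero, h'.map_zero]

theorem IsPhase.le_arctan (hk : 0 < k) (hα : 0 < α) (hα1 : α ≤ 1) (hα2 : 9 * k ^ 2 * α ≤ 1)
    (h : IsPhase k α θ) : θ 1 ≤ Real.arctan (3 * k) := by
  have hC := (truncationLevel_pos hk hα).le
  have := le_of_subsolution_of_supersolution (θ₂ := fun t => Real.arctan (3 * k * t))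
    (θ₂' := fun t => 1 / (1 + (3 * k * t) ^ 2) * (3 * k))
    (fun t ht => abs_truncatedRate_sub_le hk.le hα hC ht)
    (fun t ht => h.hasDeriv_truncated le_rfl ht)
    (fun t _ => by simpa using (((hasDerivAt_id t).const_mul (3 * k)).arctan).hasDerivWithinAt)
    (fun t _ => le_rfl) ?_ (by simp [h.map_zero]) 1 (by simp)
  · simpa using this
  intro t ht
  have ht0 := ht.1
  have hpos : 0 < 1 + (3 * k * t) ^ 2 := by positivity
  have hG := G_pos hα ht
  have hmin : min |Real.sin (Real.arctan (3 * k * t))| (truncationLevel k α * t) ≤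
      3 * k / √(1 + (3 * k * t) ^ 2) * t := by
    refine (min_le_left _ _).trans ?_
    rw [Real.sin_arctan, abs_of_nonneg (by positivity)]
    exact le_of_eq (by ring)
  have hS := truncatedSinSq_le_of_abs_min_le hC ht hmin
  rw [div_pow, Real.sq_sqrt hpos.le] at hS
  rw [truncatedRate, Real.cos_sq_arctan]
  have h1 : G α t * truncatedSinSq (truncationLevel k α) t (Real.arctan (3 * k * t)) ≤
      1 / (1 + (3 * k * t) ^ 2) := by
    refine (mul_le_mul_of_nonneg_left hS hG.le).trans ?_
    have : G α t * ((3 * k) ^ 2 / (1 + (3 * k * t) ^ 2) * t) =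
      (3 * k) ^ 2 * (G α t * t) / (1 + (3 * k * t) ^ 2) := by ring
    rw [this]
    refine div_le_div_of_nonneg_right ?_ hpos.le
    have := mul_le_mul_of_nonneg_left (G_mul_le hα ht) (sq_nonneg (3 * k))
    linarith
  have h2 : (1 + G α t) * (1 / (1 + (3 * k * t) ^ 2)) ≤ 2 * (1 / (1 + (3 * k * t) ^ 2)) :=
    mul_le_mul_of_nonneg_right (by linarith [G_le_one hα hα1 ht]) (by positivity)
  calc _ ≤ k * (2 * (1 / (1 + (3 * k * t) ^ 2)) + 1 / (1 + (3 * k * t) ^ 2)) :=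
        mul_le_mul_of_nonneg_left (add_le_add h2 h1) hk.le
    _ = _ := by ring

theorem le_rate (hk : 0 < k) (hα : 0 < α) (hτ : τ ∈ Set.Icc (0 : ℝ) 1) (x : ℝ)
    (hx : τ = 0 → Real.sin x = 0) : k * (α / (1 + α * (1 - τ) ^ 2)) ≤ rate k α τ x := by
  have hG := G_pos hα hτ
  have h1 : α / (1 + α * (1 - τ) ^ 2) ≤ G α τ :=
    div_le_div_of_nonneg_left hα.le (G_denom_pos hα hτ) (by nlinarith [sq_nonneg (1 - τ)])
  have h2 : Real.sin x ^ 2 ≤ Real.sin x ^ 2 / τ / (2 - τ) := by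
    rcases hτ.1.eq_or_lt with h0 | h0
    · simp [hx h0.symm]
    · rw [div_div, le_div_iff₀ (mul_pos h0 (by linarith [hτ.2]))]
      exact mul_le_of_le_one_right (sq_nonneg _) (by nlinarith [sq_nonneg (1 - τ)])
  refine mul_le_mul_of_nonneg_left (h1.trans ?_) hk.le
  have := mul_le_mul_of_nonneg_left h2 hG.le
  have h3 := Real.sin_sq_add_cos_sq x
  nlinarith [sq_nonneg (Real.cos x)]

theorem IsPhase.ge_arctan (hk : 0 < k) (hα : 0 < α) (h : IsPhase k α θ) :
    k * √α * Real.arctan √α ≤ θ 1 := by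
  have := le_of_subsolution_of_supersolution (K := 0) (T := 1)
    (f := fun t _ => k * (α / (1 + α * (1 - t) ^ 2)))
    (θ₁ := fun t => k * √α * (Real.arctan √α - Real.arctan (√α * (1 - t))))
    (θ₁' := fun t => k * √α * -(1 / (1 + (√α * (1 - t)) ^ 2) * (√α * (-1))))
    (by simp) (fun t _ => ?_) h.hasDeriv (fun t _ => ?_)
    (fun t ht => le_rate hk hα ht _ ?_) (by simp [h.map_zero]) 1 (by simp)
  · simpa using this
  · have h1 : HasDerivAt (fun t => √α * (1 - t)) (√α * (-1)) t :=
      ((hasDerivAt_id t).const_sub 1).const_mul _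
    exact ((h1.arctan.const_sub _).const_mul _).hasDerivWithinAt
  · rw [mul_pow, Real.sq_sqrt hα.le]
    refine le_of_eq ?_
    have := Real.mul_self_sqrt hα.le
    calc _ = k * (√α * √α / (1 + α * (1 - t) ^ 2)) := by ring
      _ = _ := by rw [this]
  · rintro rfl
    simp [h.map_zero]

/-- The phase function, chosen among the (unique) functions with `IsPhase k α`. -/
noncomputable def phase (k α : ℝ) : ℝ → ℝ := Classical.epsilon (IsPhase k α)

theorem isPhase_phase (hk : 0 < k) (hα : 0 < α) : IsPhase k α (phase k α) :=
  Classical.epsilon_spec (exists_isPhase hk hα)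

theorem strictMonoOn_phase (hk : 0 < k) : StrictMonoOn (fun α => phase k α 1) (Set.Ioi 0) :=
  fun _ hα _ hα' h => (isPhase_phase hk hα).lt_of_lt hk hα h (isPhase_phase hk hα')

theorem continuousOn_phase (hk : 0 < k) : ContinuousOn (fun α => phase k α 1) (Set.Ioi 0) := by
  intro α hα
  have hα : 0 < α := hα
  refine ContinuousAt.continuousWithinAt ?_
  set C := truncationLevel k (α + 1)
  set μ := min 1 (α / 2)
  have hμ : 0 < μ := lt_min one_pos (by positivity)
  have hlim : Tendsto (fun α' => gronwallBound 0 (k * ((2 + α) * 2 + (1 + α) * (2 * C)))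
      (k * (1 + C ^ 2) * (|α' - α| / μ ^ 2)) 1) (𝓝 α) (𝓝 0) := by
    have hc : Continuous fun α' => gronwallBound 0 (k * ((2 + α) * 2 + (1 + α) * (2 * C)))
      (k * (1 + C ^ 2) * (|α' - α| / μ ^ 2)) 1 :=
      (gronwallBound_continuous_ε _ _ _).comp (by fun_prop)
    simpa [gronwallBound_ε0_δ0] using hc.tendsto α
  refine tendsto_iff_dist_tendsto_zero.2 (squeeze_zero' (Eventually.of_forall fun _ => dist_nonneg)
    ?_ hlim)
  filter_upwards [Ioo_mem_nhds (show α / 2 < α by linarith) (show α < α + 1 by linarith)] with x hx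
  have hx0 : 0 < x := lt_trans (by positivity) hx.1
  rw [dist_comm, Real.dist_eq]
  exact (isPhase_phase hk hα).abs_sub_le hk hμ (min_le_left _ _)
    ((min_le_right _ _).trans (by linarith)) ((min_le_right _ _).trans hx.1.le)
    (truncationLevel_mono hk hα (by linarith)) (truncationLevel_mono hk hx0 hx.2.le)
    (isPhase_phase hk hx0)

theorem phase_pos (hk : 0 < k) (hα : 0 < α) : 0 < phase k α 1 :=
  (mul_pos (mul_pos hk (Real.sqrt_pos.2 hα)) (Real.arctan_pos.2 (Real.sqrt_pos.2 hα))).trans_le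
    ((isPhase_phase hk hα).ge_arctan hk hα)

theorem phase_ge (hk : 0 < k) (hα : 1 ≤ α) : k * √α * (Real.pi / 4) ≤ phase k α 1 := by
  have hα0 : 0 < α := by linarith
  refine le_trans ?_ ((isPhase_phase hk hα0).ge_arctan hk hα0)
  refine mul_le_mul_of_nonneg_left ?_ (by positivity)
  rw [← Real.arctan_one]
  exact Real.arctan_mono (Real.one_le_sqrt.2 hα)

theorem exists_phase_lt (hk : 0 < k) : ∃ α, 0 < α ∧ phase k α 1 < Real.pi / 2 := by
  have h9 : 0 < 1 / (9 * k ^ 2) := by positivity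
  refine ⟨min 1 (1 / (9 * k ^ 2)), lt_min one_pos h9, ?_⟩
  have hα := lt_min one_pos h9
  refine ((isPhase_phase hk hα).le_arctan hk hα (min_le_left _ _) ?_).trans_lt
    (Real.arctan_lt_pi_div_two _)
  have := min_le_right 1 (1 / (9 * k ^ 2))
  rwa [le_div_iff₀ (by positivity), mul_comm] at this

end EllipsoidSpheres

namespace EllipsoidSpheres

/-! ### The amplitude of the regular solution -/

theorem IsPhase.exists_amplitude {k α : ℝ} {θ : ℝ → ℝ} (hk : 0 < k) (hα : 0 < α)
    (h : IsPhase k α θ) :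
    ∃ r : ℝ → ℝ, ∃ B : ℝ, ∀ t ∈ Set.Ioc (0 : ℝ) 1, 0 < r t ∧ r t ≤ B ∧
      HasDerivWithinAt r (r t * (k * Real.sin (θ t) * Real.cos (θ t) *
        (1 + G α t - G α t / t / (2 - t)))) (Set.Icc 0 1) t := by
  set ρ : ℝ → ℝ := fun t => k * Real.sin (θ t) * Real.cos (θ t) *
        (1 + G α t - G α t / t / (2 - t)) with hρ
  set ρ' : ℝ → ℝ := fun t => ρ (min t 1)
  set M : ℝ := k * ((2 + α) + truncationLevel k α * (1 + α))
  have hsub : Set.Ioc (0 : ℝ) 1 ⊆ Set.Icc 0 1 := Set.Ioc_subset_Icc_self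
  have hmaps : Set.MapsTo (fun t : ℝ => min t 1) (Set.Ioi 0) (Set.Ioc 0 1) :=
    fun t ht => ⟨lt_min ht one_pos, min_le_right _ _⟩
  have hcont : ContinuousOn ρ (Set.Ioc 0 1) := by
    have h1 : ContinuousOn θ (Set.Ioc 0 1) :=
      ContinuousOn.mono (fun t ht => (h.hasDeriv t ht).continuousWithinAt) hsub
    have h2 : ContinuousOn (G α) (Set.Ioc 0 1) := (continuousOn_G hα).mono hsub
    refine ContinuousOn.mul ((continuousOn_const.mul (Real.continuous_sin.comp_continuousOn h1)).mul
      (Real.continuous_cos.comp_continuousOn h1)) ((continuousOn_const.add h2).sub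
      ((h2.div continuousOn_id fun t ht => ht.1.ne').div (by fun_prop) fun t ht => ?_))
    linarith [ht.2]
  have hcont' : ContinuousOn ρ' (Set.Ioi 0) :=
    hcont.comp (by fun_prop) hmaps
  have hbound : ∀ t ∈ Set.Ioc (0 : ℝ) 1, |ρ t| ≤ M := by
    intro t ht
    have hG := G_pos hα (hsub ht)
    have hG' := G_le hα (hsub ht)
    have hC := truncationLevel_pos hk hα
    have hc := Real.abs_cos_le_one (θ t)
    have h2 : 1 ≤ 2 - t := by linarith [ht.2]
    have hs : |Real.sin (θ t)| / t / (2 - t) ≤ truncationLevel k α :=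
      (div_le_self (div_nonneg (abs_nonneg _) ht.1.le) h2).trans
        ((div_le_iff₀ ht.1).2 (h.abs_sin_le t (hsub ht)))
    have hs1 : |Real.sin (θ t) * (1 + G α t - G α t / t / (2 - t))| ≤
        (2 + α) + truncationLevel k α * (1 + α) := by
      have : Real.sin (θ t) * (1 + G α t - G α t / t / (2 - t)) =
        Real.sin (θ t) * (1 + G α t) - Real.sin (θ t) / t / (2 - t) * G α t := by ring
      rw [this]
      refine (abs_sub _ _).trans (add_le_add ?_ ?_)
      · rw [abs_mul, abs_of_pos (by linarith : 0 < 1 + G α t)]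
        exact (mul_le_of_le_one_left (by linarith) (Real.abs_sin_le_one _)).trans (by linarith)
      · rw [abs_mul, abs_of_pos hG, abs_div, abs_div, abs_of_pos ht.1,
          abs_of_pos (by linarith : 0 < 2 - t)]
        exact mul_le_mul hs hG' hG.le hC.le
    have : ρ t = k * (Real.cos (θ t) *
        (Real.sin (θ t) * (1 + G α t - G α t / t / (2 - t)))) := by
      simp only [hρ]; ring
    rw [this, abs_mul, abs_of_pos hk, abs_mul]
    exact mul_le_mul_of_nonneg_left
      ((mul_le_of_le_one_left (abs_nonneg _) hc).trans hs1) hk.le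
  refine ⟨fun t => Real.exp (∫ s in (1 : ℝ)..t, ρ' s), Real.exp M, fun t ht =>
    ⟨Real.exp_pos _, Real.exp_le_exp.2 ?_, ?_⟩⟩
  · have hle := intervalIntegral.norm_integral_le_of_norm_le_const (a := 1) (b := t) (f := ρ')
      (C := M) fun s hs => by
        rw [Set.uIoc_of_ge ht.2] at hs
        exact hbound _ (hmaps (ht.1.trans hs.1))
    have hM : 0 ≤ M := (abs_nonneg _).trans (hbound 1 (by simp))
    refine (le_abs_self _).trans (hle.trans (mul_le_of_le_one_right hM ?_))
    rw [abs_le]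
    constructor <;> linarith [ht.1, ht.2]
  · have hint : IntervalIntegrable ρ' MeasureTheory.volume 1 t :=
      (hcont'.mono fun s hs => by
        rw [Set.uIcc_of_ge ht.2] at hs
        exact ht.1.trans_le hs.1).intervalIntegrable
    have hd := intervalIntegral.integral_hasDerivAt_right hint
      (hcont'.stronglyMeasurableAtFilter isOpen_Ioi t ht.1)
      (hcont'.continuousAt (Ioi_mem_nhds ht.1))
    have he : ρ' t = ρ t := by simp only [ρ', min_eq_left ht.2]
    rw [he] at hd
    exact hd.exp.hasDerivWithinAt

theorem IsPhase.hasDeriv_amplitude_mul_cos {k α t r' : ℝ} {θ r : ℝ → ℝ}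
    (h : IsPhase k α θ) (ht : t ∈ Set.Ioc (0 : ℝ) 1)
    (hr' : r' = r t * (k * Real.sin (θ t) * Real.cos (θ t) * (1 + G α t - G α t / t / (2 - t))))
    (hr : HasDerivWithinAt r r' (Set.Icc 0 1) t) :
    HasDerivWithinAt (fun t => r t * Real.cos (θ t))
      (-(G α t / t / (2 - t)) * (k * (r t * Real.sin (θ t)))) (Set.Icc 0 1) t := by
  have hθ := h.hasDeriv t ⟨ht.1.le, ht.2⟩
  refine (hr.mul hθ.cos).congr_deriv ?_
  rw [hr', rate]
  have := Real.cos_sq' (θ t)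
  linear_combination (-(k * r t * Real.sin (θ t) * (G α t / t / (2 - t)))) * this

theorem IsPhase.hasDeriv_amplitude_mul_sin {k α t r' : ℝ} {θ r : ℝ → ℝ}
    (h : IsPhase k α θ) (ht : t ∈ Set.Ioc (0 : ℝ) 1)
    (hr' : r' = r t * (k * Real.sin (θ t) * Real.cos (θ t) * (1 + G α t - G α t / t / (2 - t))))
    (hr : HasDerivWithinAt r r' (Set.Icc 0 1) t) :
    HasDerivWithinAt (fun t => r t * Real.sin (θ t))
      (k * (1 + G α t) * (r t * Real.cos (θ t))) (Set.Icc 0 1) t := by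
  have hθ := h.hasDeriv t ⟨ht.1.le, ht.2⟩
  refine (hr.mul hθ.sin).congr_deriv ?_
  rw [hr', rate]
  have := Real.cos_sq' (θ t)
  linear_combination (k * r t * Real.cos (θ t) * (1 + G α t)) * this

/-! ### The first order system -/

/-- The first order system for `(v, p v')`. -/
def IsSolution (a b d : ℝ) (v u : ℝ → ℝ) : Prop :=
  ∀ z ∈ I, HasDerivWithinAt v (u z / p a b z) I z ∧ HasDerivWithinAt u (q a b d z * v z) I z

variable {a b d : ℝ} {v u v₁ u₁ : ℝ → ℝ}

theorem radicand_pos (ha : 0 < a) (hb : 0 < b) {z : ℝ} (hz : z ∈ I) :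
    0 < a ^ 2 * (1 - z ^ 2) + b ^ 2 * z ^ 2 := by
  obtain ⟨h0, h1⟩ := hz
  have : 0 < 1 - z ^ 2 := by nlinarith
  positivity

theorem one_sub_sq_pos {z : ℝ} (hz : z ∈ I) : 0 < 1 - z ^ 2 := by
  obtain ⟨h0, h1⟩ := hz
  nlinarith

theorem p_pos (ha : 0 < a) (hb : 0 < b) {z : ℝ} (hz : z ∈ I) : 0 < p a b z :=
  div_pos (one_sub_sq_pos hz) (Real.sqrt_pos.2 (radicand_pos ha hb hz))

theorem uniqueDiffOn_I : UniqueDiffOn ℝ I := uniqueDiffOn_Ico 0 1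

theorem contDiffOn_p (ha : 0 < a) (hb : 0 < b) : ContDiffOn ℝ ∞ (p a b) I := by
  unfold p
  exact ContDiffOn.div (by fun_prop)
    (ContDiffOn.sqrt (by fun_prop) fun z hz => (radicand_pos ha hb hz).ne')
    fun z hz => (Real.sqrt_pos.2 (radicand_pos ha hb hz)).ne'

theorem contDiffOn_q (ha : 0 < a) (hb : 0 < b) (hd : 0 < d) : ContDiffOn ℝ ∞ (q a b d) I := by
  unfold q
  refine contDiffOn_const.mul (ContDiffOn.div (by fun_prop) (contDiffOn_const.mul
    (ContDiffOn.rpow_const_of_ne (by fun_prop) fun z hz => (radicand_pos ha hb hz).ne'))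
    fun z hz => ?_)
  have := Real.rpow_pos_of_pos (radicand_pos ha hb hz) (3 / 2)
  positivity

theorem IsSolution.of_L_eq_zero (ha : 0 < a) (hb : 0 < b) (hv : ContDiffOn ℝ ∞ v I)
    (hL : ∀ z ∈ I, L a b d v z = 0) : IsSolution a b d v (fun z => p a b z * D v z) := by
  intro z hz
  have hp := (p_pos ha hb hz).ne'
  have hD : ContDiffOn ℝ ∞ (D v) I := hv.derivWithin uniqueDiffOn_I (by simp)
  constructor
  · rw [mul_div_cancel_left₀ _ hp]
    exact (hv.differentiableOn (by simp) z hz).hasDerivWithinAt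
  · have h1 : DifferentiableWithinAt ℝ (fun z => p a b z * D v z) I z :=
      ((contDiffOn_p ha hb).mul hD).differentiableOn (by simp) z hz
    have h2 := hL z hz
    rw [L, mul_eq_zero, or_iff_right (one_div_ne_zero hp), neg_add_eq_zero] at h2
    rw [← h2]
    exact h1.hasDerivWithinAt

theorem IsSolution.D_eq (h : IsSolution a b d v u) {z : ℝ} (hz : z ∈ I) :
    D v z = u z / p a b z :=
  (h z hz).1.derivWithin (uniqueDiffOn_I z hz)

theorem IsSolution.p_mul_D_eq (ha : 0 < a) (hb : 0 < b) (h : IsSolution a b d v u) {z : ℝ}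
    (hz : z ∈ I) : p a b z * D v z = u z := by
  rw [h.D_eq hz, mul_div_cancel₀ _ (p_pos ha hb hz).ne']

theorem IsSolution.L_eq_zero (ha : 0 < a) (hb : 0 < b) (h : IsSolution a b d v u) {z : ℝ}
    (hz : z ∈ I) : L a b d v z = 0 := by
  have h1 : D (fun t => p a b t * D v t) z = q a b d z * v z := by
    rw [D, derivWithin_congr (f := u) (fun t ht => h.p_mul_D_eq ha hb ht) (h.p_mul_D_eq ha hb hz)]
    exact (h z hz).2.derivWithin (uniqueDiffOn_I z hz)
  rw [L, h1]
  simp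

theorem IsSolution.contDiffOn (ha : 0 < a) (hb : 0 < b) (hd : 0 < d) (h : IsSolution a b d v u) :
    ContDiffOn ℝ ∞ v I := by
  have key : ∀ n : ℕ, ContDiffOn ℝ n v I ∧ ContDiffOn ℝ n u I := by
    intro n
    induction n with
    | zero =>
      simp only [Nat.cast_zero, contDiffOn_zero]
      exact ⟨fun z hz => (h z hz).1.continuousWithinAt, fun z hz => (h z hz).2.continuousWithinAt⟩
    | succ n ih =>
      have hn : (n : WithTop ℕ∞) ≤ ∞ := by exact_mod_cast le_top
      have hp := (contDiffOn_p ha hb).of_le hn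
      have hq := (contDiffOn_q ha hb hd).of_le hn
      push_cast
      rw [contDiffOn_succ_iff_derivWithin uniqueDiffOn_I,
        contDiffOn_succ_iff_derivWithin uniqueDiffOn_I]
      refine ⟨⟨fun z hz => (h z hz).1.differentiableWithinAt, by simp, ?_⟩,
        fun z hz => (h z hz).2.differentiableWithinAt, by simp, ?_⟩
      · exact (ih.2.div hp fun z hz => (p_pos ha hb hz).ne').congr fun z hz => h.D_eq hz
      · exact (hq.mul ih.1).congr fun z hz => (h z hz).2.derivWithin (uniqueDiffOn_I z hz)
  exact contDiffOn_infty.2 fun n => (key n).1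

theorem hasDerivWithinAt_Ici_of_I {f : ℝ → ℝ} {f' z : ℝ} (hz : z ∈ I)
    (h : HasDerivWithinAt f f' I z) : HasDerivWithinAt f f' (Set.Ici z) z :=
  h.mono_of_mem_nhdsWithin (mem_of_superset (Ico_mem_nhdsGE hz.2) (Set.Ico_subset_Ico_left hz.1))

theorem Icc_subset_I {x y : ℝ} (hx : 0 ≤ x) (hy : y < 1) : Set.Icc x y ⊆ I :=
  fun _ h => ⟨hx.trans h.1, h.2.trans_lt hy⟩

theorem IsSolution.eq_zero (ha : 0 < a) (hb : 0 < b) (hd : 0 < d) (h : IsSolution a b d v u)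
    (hv : v 0 = 0) (hu : u 0 = 0) {z : ℝ} (hz : z ∈ I) : v z = 0 := by
  have hsub : Set.Icc 0 z ⊆ I := Icc_subset_I le_rfl hz.2
  have hsub' : Set.Ico 0 z ⊆ I := Set.Ico_subset_Icc_self.trans hsub
  have hc1 : ContinuousOn (fun z => 1 / p a b z) (Set.Icc 0 z) :=
    continuousOn_const.div ((contDiffOn_p ha hb).continuousOn.mono hsub)
      fun x hx => (p_pos ha hb (hsub hx)).ne'
  have hc2 : ContinuousOn (q a b d) (Set.Icc 0 z) := (contDiffOn_q ha hb hd).continuousOn.mono hsub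
  obtain ⟨K₁, hK₁⟩ := isCompact_Icc.exists_bound_of_continuousOn hc1
  obtain ⟨K₂, hK₂⟩ := isCompact_Icc.exists_bound_of_continuousOn hc2
  have hz0 := eq_zero_of_abs_deriv_le_mul_abs_self_of_eq_zero_right (E := ℝ × ℝ)
    (f := fun x => (v x, u x)) (f' := fun x => (u x / p a b x, q a b d x * v x))
    (K := max K₁ K₂) (a := 0) (b := z)
    (fun x hx => ((h x (hsub hx)).1.continuousWithinAt.prodMk
      (h x (hsub hx)).2.continuousWithinAt).mono hsub)
    (fun x hx => (hasDerivWithinAt_Ici_of_I (hsub' hx) (h x (hsub' hx)).1).prodMk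
      (hasDerivWithinAt_Ici_of_I (hsub' hx) (h x (hsub' hx)).2))
    (by simp [hv, hu]) (fun x hx => ?_) z ⟨hz.1, le_rfl⟩
  · exact congrArg Prod.fst hz0
  · have hx' : x ∈ Set.Icc 0 z := ⟨hx.1, hx.2.le⟩
    have h1 := hK₁ x hx'
    have h2 := hK₂ x hx'
    have hK : 0 ≤ max K₁ K₂ := (norm_nonneg _).trans (h1.trans (le_max_left _ _))
    rw [Prod.norm_mk, Prod.norm_mk]
    refine max_le ?_ ?_
    · rw [div_eq_mul_one_div, mul_comm, norm_mul]
      exact mul_le_mul (h1.trans (le_max_left _ _)) (le_max_right _ _) (norm_nonneg _) hK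
    · rw [norm_mul]
      exact mul_le_mul (h2.trans (le_max_right _ _)) (le_max_left _ _) (norm_nonneg _) hK

theorem IsSolution.wronskian_eq (h : IsSolution a b d v u) (h₁ : IsSolution a b d v₁ u₁) {z : ℝ}
    (hz : z ∈ I) : v₁ z * u z - u₁ z * v z = v₁ 0 * u 0 - u₁ 0 * v 0 := by
  have hsub : Set.Icc 0 z ⊆ I := Icc_subset_I le_rfl hz.2
  have hd : ∀ x ∈ I, HasDerivWithinAt (fun z => v₁ z * u z - u₁ z * v z) 0 I x := by
    intro x hx
    refine (((h₁ x hx).1.mul (h x hx).2).sub ((h₁ x hx).2.mul (h x hx).1)).congr_deriv ?_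
    ring
  exact constant_of_has_deriv_right_zero
    (fun x hx => (hd x (hsub hx)).continuousWithinAt.mono hsub)
    (fun x hx => hasDerivWithinAt_Ici_of_I (hsub ⟨hx.1, hx.2.le⟩) (hd x (hsub ⟨hx.1, hx.2.le⟩)))
    z ⟨hz.1, le_rfl⟩

theorem exists_p_ge (ha : 0 < a) (hb : 0 < b) :
    ∃ c > 0, ∀ z ∈ I, c * (1 - z) ≤ p a b z := by
  refine ⟨1 / √(a ^ 2 + b ^ 2), by positivity, fun z hz => ?_⟩
  have h1 := one_sub_sq_pos hz
  have h2 : 1 - z ≤ 1 - z ^ 2 := by nlinarith [hz.1, hz.2]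
  rw [p, one_div_mul_eq_div]
  refine div_le_div₀ h1.le h2 (Real.sqrt_pos.2 (radicand_pos ha hb hz)) (Real.sqrt_le_sqrt ?_)
  have : z ^ 2 ≤ 1 := by linarith
  nlinarith [sq_nonneg a, sq_nonneg b, sq_nonneg z]

theorem IsSolution.tendsto_mul (ha : 0 < a) (hb : 0 < b) (h : IsSolution a b d v u)
    (hu : Tendsto u (𝓝[<] 1) (𝓝 0)) : Tendsto (fun z => (1 - z) * v z) (𝓝[<] 1) (𝓝 0) := by
  obtain ⟨c, hc, hpc⟩ := exists_p_ge ha hb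
  have hev : ∀ᶠ z in 𝓝[<] (1 : ℝ), |u z| < 1 := by
    have := hu.abs
    rw [abs_zero] at this
    exact this.eventually_lt_const one_pos
  obtain ⟨l, hl, hlu⟩ := (mem_nhdsLT_iff_exists_Ioo_subset).1 hev
  have hl1 : l < 1 := hl
  obtain ⟨z₀, hz₀, hz₀1⟩ := exists_between (max_lt hl1 one_pos)
  have hz₀l : l < z₀ := (le_max_left _ _).trans_lt hz₀
  have hz₀0 : 0 ≤ z₀ := (le_max_right _ _).trans hz₀.le
  have hbound : ∀ z ∈ Set.Ico z₀ 1, ‖v z‖ ≤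
      |v z₀| + 1 / c * (Real.log (1 - z₀) - Real.log (1 - z)) := by
    intro z hz
    have hsub : Set.Icc z₀ z ⊆ I := Icc_subset_I hz₀0 hz.2
    have hB : ∀ x ∈ Set.Icc z₀ z, HasDerivAt
        (fun z => |v z₀| + 1 / c * (Real.log (1 - z₀) - Real.log (1 - z)))
        (1 / c * -(-1 / (1 - x))) x := fun x hx =>
      (((((hasDerivAt_id x).const_sub 1).log (by
        simp only [id]; linarith [hx.2, hz.2])).const_sub _).const_mul _).const_add _
    refine image_norm_le_of_norm_deriv_right_le_deriv_boundary'
      (fun x hx => (h x (hsub hx)).1.continuousWithinAt.mono hsub)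
      (fun x hx => hasDerivWithinAt_Ici_of_I (hsub ⟨hx.1, hx.2.le⟩) (h x (hsub ⟨hx.1, hx.2.le⟩)).1)
      (by simp) (fun x hx => (hB x hx).continuousAt.continuousWithinAt)
      (fun x hx => (hB x ⟨hx.1, hx.2.le⟩).hasDerivWithinAt) ?_ ⟨hz.1, le_rfl⟩
    intro x hx
    have hxI := hsub ⟨hx.1, hx.2.le⟩
    have hx1 : 0 < 1 - x := by linarith [hxI.2]
    have hux : |u x| < 1 := hlu ⟨hz₀l.trans_le hx.1, hxI.2⟩
    rw [norm_div, Real.norm_eq_abs, Real.norm_eq_abs, abs_of_pos (p_pos ha hb hxI)]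
    calc |u x| / p a b x ≤ 1 / (c * (1 - x)) :=
          div_le_div₀ zero_le_one hux.le (by positivity) (hpc x hxI)
      _ = _ := by field_simp
  have hlim : Tendsto (fun z : ℝ => (1 - z) * |v z₀| + 1 / c * ((1 - z) * Real.log (1 - z₀) -
      (1 - z) * Real.log (1 - z))) (𝓝[<] 1) (𝓝 0) := by
    have hcont : Continuous (fun z : ℝ => (1 - z) * |v z₀| + 1 / c * ((1 - z) * Real.log (1 - z₀) -
      (1 - z) * Real.log (1 - z))) := by
      have := Real.continuous_mul_log.comp
        (continuous_const.sub continuous_id : Continuous fun z : ℝ => 1 - z)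
      simp only [Function.comp_def] at this
      fun_prop
    simpa using (hcont.tendsto 1).mono_left nhdsWithin_le_nhds
  refine squeeze_zero_norm' ?_ hlim
  filter_upwards [Ico_mem_nhdsLT hz₀1] with z hz
  have hz1 : 0 ≤ 1 - z := by linarith [hz.2]
  rw [norm_mul, Real.norm_of_nonneg hz1]
  refine (mul_le_mul_of_nonneg_left (hbound z hz) hz1).trans (le_of_eq ?_)
  ring

/-- Two solutions with vanishing flux at `z = 1` are proportional, if one of them is bounded with
flux `O(1 - z)`. -/
theorem IsSolution.wronskian_eq_zero (ha : 0 < a) (hb : 0 < b) (h : IsSolution a b d v u)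
    (h₁ : IsSolution a b d v₁ u₁) (hu₁ : Tendsto u₁ (𝓝[<] 1) (𝓝 0)) {B B' : ℝ}
    (hv : ∀ z ∈ I, |v z| ≤ B) (hu : ∀ z ∈ I, |u z| ≤ B' * (1 - z)) :
    v₁ 0 * u 0 - u₁ 0 * v 0 = 0 := by
  have hI : ∀ᶠ z in 𝓝[<] (1 : ℝ), z ∈ I := Ico_mem_nhdsLT one_pos
  have h1 : Tendsto (fun z => v₁ z * u z) (𝓝[<] 1) (𝓝 0) := by
    have := ((h₁.tendsto_mul ha hb hu₁).norm.const_mul B')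
    rw [norm_zero, mul_zero] at this
    refine squeeze_zero_norm' ?_ this
    filter_upwards [hI] with z hz
    have hz1 : 0 ≤ 1 - z := by linarith [hz.2]
    rw [norm_mul, norm_mul, Real.norm_of_nonneg hz1]
    calc ‖v₁ z‖ * ‖u z‖ ≤ ‖v₁ z‖ * (B' * (1 - z)) :=
          mul_le_mul_of_nonneg_left (hu z hz) (norm_nonneg _)
      _ = _ := by ring
  have h2 : Tendsto (fun z => u₁ z * v z) (𝓝[<] 1) (𝓝 0) := by
    have := hu₁.norm.mul_const B
    rw [norm_zero, zero_mul] at this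
    refine squeeze_zero_norm' ?_ this
    filter_upwards [hI] with z hz
    rw [norm_mul]
    exact mul_le_mul_of_nonneg_left (hv z hz) (norm_nonneg _)
  have h3 := h1.sub h2
  rw [sub_zero] at h3
  refine tendsto_nhds_unique (tendsto_const_nhds.congr' ?_) h3
  filter_upwards [hI] with z hz
  exact (h.wronskian_eq h₁ hz).symm

end EllipsoidSpheres

namespace EllipsoidSpheres

variable {a b d : ℝ}

/-! ### The Gauss map coordinate -/

/-- The variable `τ = 1 - y`, where `y` is the axial component of the unit normal at `z`. -/
noncomputable def gaussCoord (a b z : ℝ) : ℝ :=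
  1 - b * z / √(a ^ 2 * (1 - z ^ 2) + b ^ 2 * z ^ 2)

theorem gaussCoord_zero : gaussCoord a b 0 = 1 := by simp [gaussCoord]

theorem one_sub_gaussCoord_sq (ha : 0 < a) (hb : 0 < b) {z : ℝ} (hz : z ∈ I) :
    (1 - gaussCoord a b z) ^ 2 = b ^ 2 * z ^ 2 / (a ^ 2 * (1 - z ^ 2) + b ^ 2 * z ^ 2) := by
  rw [gaussCoord, sub_sub_cancel, div_pow, Real.sq_sqrt (radicand_pos ha hb hz).le, mul_pow]

theorem gaussCoord_mul (ha : 0 < a) (hb : 0 < b) {z : ℝ} (hz : z ∈ I) :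
    gaussCoord a b z * (2 - gaussCoord a b z) =
      a ^ 2 * (1 - z ^ 2) / (a ^ 2 * (1 - z ^ 2) + b ^ 2 * z ^ 2) := by
  have hR := (radicand_pos ha hb hz).ne'
  have h := one_sub_gaussCoord_sq ha hb hz
  have : gaussCoord a b z * (2 - gaussCoord a b z) = 1 - (1 - gaussCoord a b z) ^ 2 := by ring
  rw [this, h, eq_div_iff hR, sub_mul, div_mul_cancel₀ _ hR]
  ring

theorem gaussCoord_mem (ha : 0 < a) (hb : 0 < b) {z : ℝ} (hz : z ∈ I) :
    gaussCoord a b z ∈ Set.Ioc (0 : ℝ) 1 := by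
  have hR := radicand_pos ha hb hz
  have h1 : gaussCoord a b z ≤ 1 := by
    have := hz.1
    rw [gaussCoord, sub_le_self_iff]
    positivity
  have h2 : 0 < gaussCoord a b z * (2 - gaussCoord a b z) := by
    rw [gaussCoord_mul ha hb hz]
    have := one_sub_sq_pos hz
    positivity
  exact ⟨pos_of_mul_pos_left h2 (by linarith), h1⟩

theorem gaussCoord_le (ha : 0 < a) (hb : 0 < b) {z : ℝ} (hz : z ∈ I) :
    gaussCoord a b z ≤ 2 * a ^ 2 / min (a ^ 2) (b ^ 2) * (1 - z) := by
  have hm := gaussCoord_mem ha hb hz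
  have h1 : gaussCoord a b z ≤ gaussCoord a b z * (2 - gaussCoord a b z) :=
    le_mul_of_one_le_right hm.1.le (by linarith [hm.2])
  refine h1.trans ?_
  rw [gaussCoord_mul ha hb hz, div_mul_eq_mul_div]
  have hz1 : 0 ≤ 1 - z := by linarith [hz.2]
  have h2 : 1 - z ^ 2 ≤ 2 * (1 - z) := by nlinarith [sq_nonneg (1 - z)]
  refine div_le_div₀ (by positivity) ?_ (lt_min (by positivity) (by positivity)) ?_
  · nlinarith [sq_nonneg a]
  · have := one_sub_sq_pos hz
    nlinarith [min_le_left (a ^ 2) (b ^ 2), min_le_right (a ^ 2) (b ^ 2), sq_nonneg z]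

theorem G_gaussCoord (ha : 0 < a) (hb : 0 < b) {z : ℝ} (hz : z ∈ I) :
    G ((a / b) ^ 2) (gaussCoord a b z) = (a ^ 2 * (1 - z ^ 2) + b ^ 2 * z ^ 2) / b ^ 2 := by
  have hR := radicand_pos ha hb hz
  rw [G, gaussCoord_mul ha hb hz, one_sub_gaussCoord_sq ha hb hz]
  set R := a ^ 2 * (1 - z ^ 2) + b ^ 2 * z ^ 2
  have : a ^ 2 * (1 - z ^ 2) / R + (a / b) ^ 2 * (b ^ 2 * z ^ 2 / R) = a ^ 2 / R := by
    field_simp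
    ring
  rw [this]
  field_simp

theorem rpow_three_halves {x : ℝ} (hx : 0 < x) : x ^ (3 / 2 : ℝ) = x * √x := by
  rw [Real.sqrt_eq_rpow, ← Real.rpow_one_add' hx.le (by norm_num)]
  norm_num

theorem hasDerivAt_gaussCoord (ha : 0 < a) (hb : 0 < b) {z : ℝ} (hz : z ∈ I) :
    HasDerivAt (gaussCoord a b) (-(b * a ^ 2 / (a ^ 2 * (1 - z ^ 2) + b ^ 2 * z ^ 2) ^ (3 / 2 : ℝ)))
      z := by
  have hR := radicand_pos ha hb hz
  have hR' : HasDerivAt (fun z => a ^ 2 * (1 - z ^ 2) + b ^ 2 * z ^ 2)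
      (a ^ 2 * (-(2 * z)) + b ^ 2 * (2 * z)) z := by
    have h2 : HasDerivAt (fun z : ℝ => z ^ 2) (2 * z) z := by simpa using hasDerivAt_pow 2 z
    exact ((h2.const_sub 1).const_mul _).add (h2.const_mul _)
  have hs := Real.sqrt_pos.2 hR
  refine ((((hasDerivAt_id z).const_mul b).div (hR'.sqrt hR.ne') hs.ne').const_sub 1).congr_deriv ?_
  rw [rpow_three_halves hR, Real.sq_sqrt hR.le]
  have hsq := Real.mul_self_sqrt hR.le
  set s := √(a ^ 2 * (1 - z ^ 2) + b ^ 2 * z ^ 2)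
  simp only [id]
  rw [neg_inj, div_eq_div_iff hR.ne' (mul_pos hR hs).ne']
  field_simp
  rw [sq s, hsq]
  ring

/-! ### The regular solution in the original coordinate -/

/-- The solution with vanishing flux at `z = 1`, in polar form at `z = 0`. -/
theorem exists_regular_solution (ha : 0 < a) (hb : 0 < b) (hd : 0 < d) :
    ∃ v u : ℝ → ℝ, IsSolution a b d v u ∧ (∃ B, ∀ z ∈ I, |v z| ≤ B) ∧
      (∃ B, ∀ z ∈ I, |u z| ≤ B * (1 - z)) ∧
      ∃ r₁ > 0, ∃ r₂ > 0, v 0 = r₁ * Real.cos (phase (b / d) ((a / b) ^ 2) 1) ∧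
        u 0 = r₂ * Real.sin (phase (b / d) ((a / b) ^ 2) 1) := by
  have hk : 0 < b / d := by positivity
  have hα : 0 < (a / b) ^ 2 := by positivity
  have hθ := isPhase_phase hk hα
  set k := b / d with hkdef
  set α := (a / b) ^ 2 with hαdef
  set θ := phase k α
  obtain ⟨r, B, hr⟩ := hθ.exists_amplitude hk hα
  have hmaps : Set.MapsTo (gaussCoord a b) I (Set.Icc 0 1) :=
    fun z hz => Set.Ioc_subset_Icc_self (gaussCoord_mem ha hb hz)
  have hB : 0 < B := (hr 1 (by simp)).1.trans_le (hr 1 (by simp)).2.1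
  have hC := truncationLevel_pos hk hα
  refine ⟨fun z => r (gaussCoord a b z) * Real.cos (θ (gaussCoord a b z)),
    fun z => k / b * (r (gaussCoord a b z) * Real.sin (θ (gaussCoord a b z))), ?_,
    ⟨B, fun z hz => ?_⟩, ⟨k / b * (B * (truncationLevel k α *
      (2 * a ^ 2 / min (a ^ 2) (b ^ 2)))), fun z hz => ?_⟩,
    r 1, (hr 1 (by simp)).1, k / b * r 1, mul_pos (by positivity) (hr 1 (by simp)).1, ?_, ?_⟩
  · intro z hz
    have hm := gaussCoord_mem ha hb hz
    have hR := radicand_pos ha hb hz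
    have h1 := hθ.hasDeriv_amplitude_mul_cos hm rfl (hr _ hm).2.2
    have h2 := hθ.hasDeriv_amplitude_mul_sin hm rfl (hr _ hm).2.2
    have hg := (hasDerivAt_gaussCoord ha hb hz).hasDerivWithinAt (s := I)
    have hz1 := one_sub_sq_pos hz
    have hs := Real.sqrt_pos.2 hR
    have hsq := Real.mul_self_sqrt hR.le
    constructor
    · refine (h1.comp z hg hmaps).congr_deriv ?_
      rw [div_div, gaussCoord_mul ha hb hz, G_gaussCoord ha hb hz, p, rpow_three_halves hR]
      set s := √(a ^ 2 * (1 - z ^ 2) + b ^ 2 * z ^ 2)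
      rw [← hsq]
      field_simp
    · refine ((h2.comp z hg hmaps).const_mul (k / b)).congr_deriv ?_
      rw [G_gaussCoord ha hb hz, q, rpow_three_halves hR, hkdef]
      set s := √(a ^ 2 * (1 - z ^ 2) + b ^ 2 * z ^ 2)
      field_simp
      ring
  · have h := hr _ (gaussCoord_mem ha hb hz)
    rw [abs_mul, abs_of_pos h.1]
    exact (mul_le_of_le_one_right h.1.le (Real.abs_cos_le_one _)).trans h.2.1
  · have hm := gaussCoord_mem ha hb hz
    have h := hr _ hm
    rw [abs_mul, abs_mul, abs_of_pos h.1, abs_of_pos (by positivity : 0 < k / b), mul_assoc,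
      mul_assoc, mul_assoc]
    refine mul_le_mul_of_nonneg_left (mul_le_mul h.2.1 ?_ (abs_nonneg _) hB.le) (by positivity)
    exact (hθ.abs_sin_le _ (hmaps hz)).trans
      (mul_le_mul_of_nonneg_left (gaussCoord_le ha hb hz) hC.le)
  · simp only [gaussCoord_zero]
  · simp only [gaussCoord_zero, mul_assoc]

theorem zero_mem_I : (0 : ℝ) ∈ I := ⟨le_rfl, one_pos⟩

theorem IsSolution.tendsto_flux {v u : ℝ → ℝ} (ha : 0 < a) (hb : 0 < b) (h : IsSolution a b d v u)
    {B : ℝ} (hu : ∀ z ∈ I, |u z| ≤ B * (1 - z)) :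
    Tendsto (fun z => p a b z * D v z) (𝓝[<] 1) (𝓝 0) := by
  have hc : Continuous fun z : ℝ => B * (1 - z) := by fun_prop
  have hlim : Tendsto (fun z : ℝ => B * (1 - z)) (𝓝[<] 1) (𝓝 0) := by
    simpa using (hc.tendsto 1).mono_left nhdsWithin_le_nhds
  refine squeeze_zero_norm' ?_ hlim
  filter_upwards [Ico_mem_nhdsLT one_pos] with z hz
  rw [h.p_mul_D_eq ha hb hz]
  exact hu z hz

theorem isEigenvalue_even_iff (ha : 0 < a) (hb : 0 < b) (hd : 0 < d) :
    IsEigenvalue a b d (VEven a b) 0 ↔ Real.sin (phase (b / d) ((a / b) ^ 2) 1) = 0 := by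
  obtain ⟨v, u, h, ⟨B, hv⟩, ⟨B', hu⟩, r₁, hr₁, r₂, hr₂, hv0, hu0⟩ :=
    exists_regular_solution ha hb hd
  constructor
  · rintro ⟨w, ⟨hw, hw0, hwlim⟩, ⟨z, hz, hwz⟩, hL⟩
    have hs := IsSolution.of_L_eq_zero ha hb hw fun z hz => by rw [hL z hz, zero_mul]
    have hW := h.wronskian_eq_zero ha hb hs hwlim hv hu
    have hne : w 0 ≠ 0 := fun h0 => hwz (hs.eq_zero ha hb hd h0 (by simp [hw0]) hz)
    simp only [hw0, mul_zero, zero_mul, sub_zero, hu0, mul_eq_zero] at hW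
    exact (hW.resolve_left hne).resolve_left hr₂.ne'
  · intro hs
    have hc : Real.cos (phase (b / d) ((a / b) ^ 2) 1) ≠ 0 := fun hc => by
      have := Real.sin_sq_add_cos_sq (phase (b / d) ((a / b) ^ 2) 1)
      simp [hs, hc] at this
    refine ⟨v, ⟨h.contDiffOn ha hb hd, ?_, h.tendsto_flux ha hb hu⟩,
      ⟨0, zero_mem_I, hv0 ▸ mul_ne_zero hr₁.ne' hc⟩,
      fun z hz => by rw [h.L_eq_zero ha hb hz, zero_mul]⟩
    rw [h.D_eq zero_mem_I, hu0, hs, mul_zero, zero_div]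

theorem isEigenvalue_odd_iff (ha : 0 < a) (hb : 0 < b) (hd : 0 < d) :
    IsEigenvalue a b d (VOdd a b) 0 ↔ Real.cos (phase (b / d) ((a / b) ^ 2) 1) = 0 := by
  obtain ⟨v, u, h, ⟨B, hv⟩, ⟨B', hu⟩, r₁, hr₁, r₂, hr₂, hv0, hu0⟩ :=
    exists_regular_solution ha hb hd
  constructor
  · rintro ⟨w, ⟨hw, hw0, hwlim⟩, ⟨z, hz, hwz⟩, hL⟩
    have hs := IsSolution.of_L_eq_zero ha hb hw fun z hz => by rw [hL z hz, zero_mul]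
    have hW := h.wronskian_eq_zero ha hb hs hwlim hv hu
    have hne : p a b 0 * D w 0 ≠ 0 := fun h0 => hwz (hs.eq_zero ha hb hd hw0 h0 hz)
    rw [hw0, zero_mul, zero_sub, neg_eq_zero, hv0] at hW
    exact ((mul_eq_zero.1 hW).resolve_left hne |> mul_eq_zero.1).resolve_left hr₁.ne'
  · intro hc
    have hs : Real.sin (phase (b / d) ((a / b) ^ 2) 1) ≠ 0 := fun hs => by
      have := Real.sin_sq_add_cos_sq (phase (b / d) ((a / b) ^ 2) 1)
      simp [hs, hc] at this
    refine ⟨v, ⟨h.contDiffOn ha hb hd, by rw [hv0, hc, mul_zero], h.tendsto_flux ha hb hu⟩, ?_,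
      fun z hz => by rw [h.L_eq_zero ha hb hz, zero_mul]⟩
    by_contra! hzero
    have h1 : D v 0 = 0 := by
      rw [D, derivWithin_congr (f := fun _ => 0) hzero (hzero 0 zero_mem_I)]
      simp
    have h2 := h.p_mul_D_eq ha hb zero_mem_I
    rw [h1, mul_zero, hu0] at h2
    exact mul_ne_zero hr₂.ne' hs h2.symm

/-! ### The degeneracy instants -/

/-- The phase at the equator as a function of the semiaxis `a`. -/
noncomputable def equatorPhase (b d a : ℝ) : ℝ := phase (b / d) ((a / b) ^ 2) 1

theorem equatorPhase_pos (ha : 0 < a) (hb : 0 < b) (hd : 0 < d) : 0 < equatorPhase b d a :=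
  phase_pos (by positivity) (by positivity)

theorem strictMonoOn_equatorPhase (hb : 0 < b) (hd : 0 < d) :
    StrictMonoOn (equatorPhase b d) (Set.Ioi 0) := by
  intro x hx y hy hxy
  have hx : 0 < x := hx
  have hy : 0 < y := hy
  refine strictMonoOn_phase (div_pos hb hd) (show 0 < (x / b) ^ 2 by positivity)
    (show 0 < (y / b) ^ 2 by positivity) ?_
  gcongr

theorem continuousOn_equatorPhase (hb : 0 < b) (hd : 0 < d) :
    ContinuousOn (equatorPhase b d) (Set.Ioi 0) :=
  (continuousOn_phase (div_pos hb hd)).comp (f := fun a => (a / b) ^ 2) (by fun_prop)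
    fun x hx => by have hx : 0 < x := hx; exact show 0 < (x / b) ^ 2 by positivity

theorem equatorPhase_ge (hb : 0 < b) (hd : 0 < d) (hab : b ≤ a) :
    a / (2 * d) * (Real.pi / 2) ≤ equatorPhase b d a := by
  have ha : 0 < a := hb.trans_le hab
  have h1 : 1 ≤ a / b := (one_le_div hb).2 hab
  refine le_of_eq_of_le ?_ (phase_ge (div_pos hb hd) (one_le_pow₀ h1))
  rw [Real.sqrt_sq (by positivity)]
  field_simp
  norm_num

theorem exists_equatorPhase_lt (hb : 0 < b) (hd : 0 < d) :
    ∃ a, 0 < a ∧ equatorPhase b d a < Real.pi / 2 := by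
  obtain ⟨α, hα, h⟩ := exists_phase_lt (div_pos hb hd)
  refine ⟨b * √α, by positivity, ?_⟩
  rwa [equatorPhase, mul_div_cancel_left₀ _ hb.ne', Real.sq_sqrt hα.le]

theorem exists_equatorPhase_eq (hb : 0 < b) (hd : 0 < d) {m : ℕ} (hm : 1 ≤ m) :
    ∃ a, 0 < a ∧ equatorPhase b d a = m * (Real.pi / 2) := by
  obtain ⟨x, hx, hxlt⟩ := exists_equatorPhase_lt hb hd
  have hm' : (1 : ℝ) ≤ m := by exact_mod_cast hm
  have hpi := Real.pi_pos
  have hxm : equatorPhase b d x ≤ m * (Real.pi / 2) := by nlinarith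
  set y := max b (2 * d * m)
  have hy : 0 < y := hb.trans_le (le_max_left _ _)
  have hym : m * (Real.pi / 2) ≤ equatorPhase b d y := by
    refine le_trans ?_ (equatorPhase_ge hb hd (le_max_left _ _))
    refine mul_le_mul_of_nonneg_right ?_ (by positivity)
    rw [le_div_iff₀ (by positivity), mul_comm]
    exact le_max_right _ _
  obtain ⟨a, ha, h⟩ := isPreconnected_Ioi.intermediate_value (Set.mem_Ioi.2 hx) (Set.mem_Ioi.2 hy)
    (continuousOn_equatorPhase hb hd) ⟨hxm, hym⟩
  exact ⟨a, ha, h⟩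

theorem mem_evenInstants_iff (hb : 0 < b) (hd : 0 < d) :
    a ∈ evenInstants b d ↔
      0 < a ∧ ∃ n : ℕ, 1 ≤ n ∧ equatorPhase b d a = (2 * n : ℕ) * (Real.pi / 2) := by
  refine and_congr_right fun ha => ?_
  rw [isEigenvalue_even_iff ha hb hd, Real.sin_eq_zero_iff]
  have hpos := equatorPhase_pos ha hb hd
  constructor
  · rintro ⟨n, hn⟩
    change _ = equatorPhase b d a at hn
    rw [← hn, mul_pos_iff_of_pos_right Real.pi_pos, Int.cast_pos] at hpos
    lift n to ℕ using hpos.le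
    refine ⟨n, by exact_mod_cast hpos, ?_⟩
    rw [← hn]
    push_cast
    ring
  · rintro ⟨n, -, hn⟩
    refine ⟨n, ?_⟩
    change _ = equatorPhase b d a
    rw [hn]
    push_cast
    ring

theorem mem_oddInstants_iff (hb : 0 < b) (hd : 0 < d) :
    a ∈ oddInstants b d ↔
      0 < a ∧ ∃ n : ℕ, equatorPhase b d a = (2 * n + 1 : ℕ) * (Real.pi / 2) := by
  refine and_congr_right fun ha => ?_
  rw [isEigenvalue_odd_iff ha hb hd, Real.cos_eq_zero_iff]
  have hpos := equatorPhase_pos ha hb hd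
  have hpi := Real.pi_pos
  constructor
  · rintro ⟨n, hn⟩
    change equatorPhase b d a = _ at hn
    rw [hn] at hpos
    have h1 : (0 : ℝ) < 2 * n + 1 := by
      by_contra! hle
      nlinarith
    have h2 : 0 ≤ n := by
      have : (0 : ℤ) < 2 * n + 1 := by exact_mod_cast h1
      omega
    lift n to ℕ using h2
    refine ⟨n, ?_⟩
    rw [hn]
    push_cast
    ring
  · rintro ⟨n, hn⟩
    refine ⟨n, ?_⟩
    change equatorPhase b d a = _
    rw [hn]
    push_cast
    ring

theorem isMergedSequence_of_equatorPhase_eq (hb : 0 < b) (hd : 0 < d) {u : ℕ → ℝ}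
    (hu : ∀ m, 1 ≤ m → 0 < u m ∧ equatorPhase b d (u m) = m * (Real.pi / 2)) :
    IsMergedSequence b d u := by
  have hmono : StrictMonoOn u (Set.Ici 1) := by
    intro m hm n hn hmn
    rw [← (strictMonoOn_equatorPhase hb hd).lt_iff_lt (hu m hm).1 (hu n hn).1, (hu m hm).2,
      (hu n hn).2]
    have : (m : ℝ) < n := by exact_mod_cast hmn
    have := Real.pi_pos
    gcongr
  have hinj := (strictMonoOn_equatorPhase hb hd).injOn
  refine ⟨hmono, ⟨?_, ?_⟩, ⟨?_, ?_⟩⟩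
  · intro m hm n hn hmn
    have : 1 ≤ m := hm
    exact hmono (Set.mem_Ici.2 (by omega)) (Set.mem_Ici.2 (by omega)) (by omega)
  · ext x
    rw [mem_evenInstants_iff hb hd]
    constructor
    · rintro ⟨n, hn, rfl⟩
      have hn : 1 ≤ n := hn
      exact ⟨(hu _ (by omega)).1, n, hn, (hu _ (by omega)).2⟩
    · rintro ⟨hx, n, hn, hxn⟩
      have := hu (2 * n) (by omega)
      exact ⟨n, hn, hinj this.1 hx (this.2.trans hxn.symm)⟩
  · intro m _ n _ hmn
    exact hmono (Set.mem_Ici.2 (by omega)) (Set.mem_Ici.2 (by omega)) (by omega)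
  · ext x
    rw [mem_oddInstants_iff hb hd]
    constructor
    · rintro ⟨n, -, rfl⟩
      exact ⟨(hu _ (by omega)).1, n, (hu _ (by omega)).2⟩
    · rintro ⟨hx, n, hxn⟩
      have := hu (2 * n + 1) (by omega)
      exact ⟨n, Set.mem_Ici.2 (Nat.zero_le n), hinj this.1 hx (this.2.trans hxn.symm)⟩

theorem exists_isMergedSequence (hb : 0 < b) (hd : 0 < d) :
    ∃ u : ℕ → ℝ, IsMergedSequence b d u ∧
      ∀ m, 1 ≤ m → 0 < u m ∧ equatorPhase b d (u m) = m * (Real.pi / 2) := by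
  choose! u hu using fun (m : ℕ) (hm : 1 ≤ m) => exists_equatorPhase_eq hb hd hm
  exact ⟨u, isMergedSequence_of_equatorPhase_eq hb hd hu, hu⟩

theorem IsMergedSequence.range_eq {u : ℕ → ℝ} (h : IsMergedSequence b d u) :
    Set.range (fun n => u (n + 1)) = evenInstants b d ∪ oddInstants b d := by
  obtain ⟨-, ⟨-, he⟩, -, ho⟩ := h
  rw [← he, ← ho]
  ext x
  constructor
  · rintro ⟨n, rfl⟩
    rcases Nat.even_or_odd' (n + 1) with ⟨k, hk | hk⟩
    · exact Or.inl ⟨k, Set.mem_Ici.2 (by omega), by simp only [hk]⟩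
    · exact Or.inr ⟨k, Set.mem_Ici.2 (by omega), by simp only [hk]⟩
  · rintro (⟨n, hn, rfl⟩ | ⟨n, -, rfl⟩)
    · have hn : 1 ≤ n := hn
      exact ⟨2 * n - 1, by simp only; congr 1; omega⟩
    · exact ⟨2 * n, rfl⟩

theorem IsMergedSequence.eq {u u' : ℕ → ℝ} (h : IsMergedSequence b d u)
    (h' : IsMergedSequence b d u') {m : ℕ} (hm : 1 ≤ m) : u m = u' m := by
  have hmono : ∀ {w : ℕ → ℝ}, IsMergedSequence b d w → StrictMono fun n => w (n + 1) :=
    fun hw _ _ hmn => hw.1 (Set.mem_Ici.2 (by omega)) (Set.mem_Ici.2 (by omega)) (by omega)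
  have := ((hmono h).range_inj (hmono h')).1 (h.range_eq.trans h'.range_eq.symm)
  obtain ⟨n, rfl⟩ := Nat.exists_eq_add_of_le' hm
  exact congrFun this n

theorem IsMergedSequence.le (hb : 0 < b) (hd : 0 < d) {u : ℕ → ℝ} (h : IsMergedSequence b d u)
    {m : ℕ} (hm : 1 ≤ m) (hbm : b ≤ 2 * d * m) : u m ≤ 2 * d * m := by
  obtain ⟨w, hw, hwm⟩ := exists_isMergedSequence hb hd
  rw [h.eq hw hm]
  obtain ⟨h1, h2⟩ := hwm m hm
  rw [← (strictMonoOn_equatorPhase hb hd).le_iff_le h1 (Set.mem_Ioi.2 (hb.trans_le hbm)), h2]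
  refine le_of_eq_of_le ?_ (equatorPhase_ge hb hd hbm)
  rw [mul_div_cancel_left₀ _ (by positivity)]

end EllipsoidSpheres

theorem mainTheorem8 (b d : ℝ) (hb : 0 < b) (hd : 0 < d) :
    (∃ a : ℕ → ℝ, EllipsoidSpheres.IsMergedSequence b d a) ∧
    ∀ a : ℕ → ℝ, EllipsoidSpheres.IsMergedSequence b d a →
      limsup (fun m : ℕ => ((a m / (m : ℝ) : ℝ) : EReal)) atTop ≤ ((2 * d : ℝ) : EReal) := by
  refine ⟨(EllipsoidSpheres.exists_isMergedSequence hb hd).imp fun _ h => h.1, fun a ha => ?_⟩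
  refine limsup_le_of_le (by isBoundedDefault) ?_
  obtain ⟨N, hN⟩ := exists_nat_ge (b / (2 * d))
  filter_upwards [eventually_ge_atTop (max N 1)] with m hm
  have hm1 : 1 ≤ m := (le_max_right _ _).trans hm
  have hmN : (N : ℝ) ≤ m := by exact_mod_cast (le_max_left _ _).trans hm
  have hm0 : (0 : ℝ) < m := by exact_mod_cast hm1
  have hbm : b ≤ 2 * d * m := by
    rw [div_le_iff₀ (by positivity)] at hN
    nlinarith
  rw [EReal.coe_le_coe_iff, div_le_iff₀ hm0]
  exact ha.le hb hd hm1 hbm
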